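/- Let $\mathcal T=\mathbf K(\mathbf{Ab})$ be the homotopy category of cochain complexes of abelian groups. It is a triangulated category with coproducts. A $\mathcal T$-module is a functor $\mathcal T^{op}\to\mathbf{Ab}$, and it is finitely presentable if there is an exact sequence $\mathcal T(-,y)\to\mathcal T(-,x)\to X\to 0$ with $x,y\in\mathcal T$. Let $\mathcal A(\mathcal T)$ be the category of all finitely presentable $\mathcal T$-modules and all natural transformations $\mathrm{Hom}_{\mathcal T}(X,Y)$ between them; it is an abelian category with small Hom-sets and with coproducts (the abelianization of $\mathcal T$). For a regular cardinal $\kappa$ let $\mathbf{Ab}_\kappa$ be the closure under direct sums and direct summands of the class of abelian groups of cardinality smaller than $\kappa$. An $\mathbf{Ab}_\kappa$-precover of an abelian group $A$ is a homomorphism $X_A\to A$ with $X_A\in\mathbf{Ab}_\kappa$ such that $\mathrm{Hom}(X,X_A)\to\mathrm{Hom}(X,A)$ is surjective for all $X\in\mathbf{Ab}_\kappa$; every abelian group has an $\mathbf{Ab}_\kappa$-precover. Given $A$, put $A^0=A$ and, inductively for $n\ge 0$, choose an $\mathbf{Ab}_\kappa$-precover $Y_\kappa^{-n}\to A^{-n}$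 and let $A^{-n-1}$ be its kernel. Let $$Y_{A,\kappa}:\ \cdots\to Y_\kappa^{-2}\to Y_\kappa^{-1}\to Y_\kappa^{0}\to A\to 0$$ be the complex (with $Y_\kappa^{-n}$ in degree $-n$ and $A$ in degree $1$) whose differentials are the precover $Y_\kappa^0\to A$ and the compositions $Y_\kappa^{-n}\to A^{-n}\to Y_\kappa^{-n+1}$, $n\geq 1$. Then, for every choice of these precovers, the product over the class of all regular cardinals $$F=\prod_{\kappa\ \mathrm{regular}}\mathcal T(-,Y_{\mathbb Z^\kappa,\kappa}):\mathcal T^{op}\to\mathbf{Ab}$$ is well defined (its values are small abelian groups), it is cohomological, sends coproducts to products, and is not representable. Moreover $$F^*:\mathcal A(\mathcal T)^{op}\to\mathbf{Ab},\qquad F^*(X)=\mathrm{Hom}_{\mathcal T}(X,F),$$ is well defined (its values are small abelian groups), and it is an exact contravariant functor that sends coproducts to products but is not representable. In particular, there is a non-representable exact contravariant functor $\mathcal A(\mathbf K(\mathbf{Ab}))\to\mathbf{Ab}$ that sends coproducts to products. -/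

import Mathlib

open CategoryTheory CategoryTheory.Limits Opposite
open scoped CategoryTheory.Pretriangulated.Opposite DirectSum

universe u v w

noncomputable section

namespace KAbExample

/-! ### Modules over a preadditive category and the abelianization -/

section Abelianization

variable (T : Type w) [Category.{v} T] [Preadditive T]

/-- A `T`-module `X : Tᵒᵖ ⥤ Ab` is finitely presentable if there is an exact sequence
`T(-, y) ⟶ T(-, x) ⟶ X ⟶ 0`. -/
def finitelyPresentable : ObjectProperty (Tᵒᵖ ⥤ AddCommGrpCat.{v}) := fun X =>
  ∃ (x y : T) (f : preadditiveYoneda.obj y ⟶ preadditiveYoneda.obj x)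
    (p : preadditiveYoneda.obj x ⟶ X) (hfp : f ≫ p = 0),
    (ShortComplex.mk f p hfp).Exact ∧ Epi p

/-- The category `A(T) = mod(T)` of finitely presentable `T`-modules, with all natural
transformations as morphisms (the abelianization, if `T` is triangulated). -/
abbrev Abelianization : Type _ := (finitelyPresentable T).FullSubcategory

variable {T}

/-- For a `T`-module `F`, the contravariant functor `X ↦ Hom_T(X, F)` on `A(T)`. A priori
its values are abelian groups in the larger universe where natural transformations live. -/
def homInto (F : Tᵒᵖ ⥤ AddCommGrpCat.{v}) :
    (Abelianization T)ᵒᵖ ⥤ AddCommGrpCat.{max w v} :=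
  (finitelyPresentable T).ι.op ⋙ preadditiveYoneda.obj F

end Abelianization

/-- A contravariant functor to abelian groups sends `u`-small coproducts to products: whenever
`c` is a coproduct of the `X j`, the canonical map `F(c) ⟶ ∏ j, F(X j)` is bijective. -/
def SendsCoproductsToProducts {C : Type w} [Category.{v} C]
    (F : Cᵒᵖ ⥤ AddCommGrpCat.{u}) : Prop :=
  ∀ (J : Type u) (X : J → C) (c : Cofan X), Nonempty (IsColimit c) →
    Function.Bijective
      (fun (x : F.obj (op c.pt)) (j : J) => (F.map (c.inj j).op).hom x)

/-- A contravariant functor `F` with values in (small) abelian groups is representable if it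
is isomorphic to `Hom(-, X)` for some object `X`; the universe lift only allows for categories
whose morphisms formally live in a larger universe. -/
def IsRepresentableAb {C : Type w} [Category.{max u v} C] [Preadditive C]
    (F : Cᵒᵖ ⥤ AddCommGrpCat.{u}) : Prop :=
  ∃ X : C, Nonempty (F ⋙ AddCommGrpCat.uliftFunctor.{v, u} ≅ preadditiveYoneda.obj X)

/-! ### Precovers by small abelian groups -/

/-- `AbLT κ` is the closure under direct sums and direct summands of the class of all abelian
groups of cardinality smaller than `κ`. -/
inductive AbLT (κ : Cardinal.{u}) : AddCommGrpCat.{u} → Prop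
  | of_card_lt (A : AddCommGrpCat.{u}) (hA : Cardinal.mk A < κ) : AbLT κ A
  | directSum (ι : Type u) (G : ι → AddCommGrpCat.{u}) (hG : ∀ i, AbLT κ (G i)) :
      AbLT κ (AddCommGrpCat.of (⨁ i, G i))
  | directSummand (A B : AddCommGrpCat.{u}) (r : Retract A B) (hB : AbLT κ B) : AbLT κ A

/-- An `AbLT κ`-precover of the abelian group `A`. -/
structure Precover (κ : Cardinal.{u}) (A : AddCommGrpCat.{u}) where
  /-- the source of the precover -/
  obj : AddCommGrpCat.{u}
  mem : AbLT κ obj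
  /-- the precover -/
  map : obj ⟶ A
  exists_lift : ∀ (X : AddCommGrpCat.{u}), AbLT κ X → ∀ g : X ⟶ A, ∃ h : X ⟶ obj, h ≫ map = g

section Resolution

variable {κ : Cardinal.{u}} (c : ℕ → ∀ B : AddCommGrpCat.{u}, Precover κ B)
  (A : AddCommGrpCat.{u})

/-- The group `A⁻ⁿ`: `A⁰ = A`, and `A⁻⁽ⁿ⁺¹⁾` is the kernel of the precover `Y⁻ⁿ ⟶ A⁻ⁿ`. Here
`c n` is the choice of precovers used in the `n`-th step. -/
def syzygy : ℕ → AddCommGrpCat.{u}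
  | 0 => A
  | n + 1 => kernel (c n (syzygy n)).map

/-- The terms `A, Y⁰, Y⁻¹, Y⁻², …`. -/
def resolutionX : ℕ → AddCommGrpCat.{u}
  | 0 => A
  | n + 1 => (c n (syzygy c A n)).obj

/-- The precover `Y⁻ⁿ ⟶ A⁻ⁿ`. -/
def resolutionCover (n : ℕ) : resolutionX c A (n + 1) ⟶ syzygy c A n :=
  (c n (syzygy c A n)).map

/-- The inclusion `A⁻⁽ⁿ⁺¹⁾ ⟶ Y⁻ⁿ` of the kernel, preceded by the identity `A⁰ ⟶ A`. -/
def resolutionIncl : ∀ n, syzygy c A n ⟶ resolutionX c A n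
  | 0 => 𝟙 A
  | n + 1 => kernel.ι (c n (syzygy c A n)).map

lemma resolutionIncl_comp_cover (n : ℕ) :
    resolutionIncl c A (n + 1) ≫ resolutionCover c A n = 0 :=
  kernel.condition (c n (syzygy c A n)).map

/-- The differentials: the compositions `Y⁻ⁿ ⟶ A⁻ⁿ ⟶ Y⁻ⁿ⁺¹` (for `n = 0`, the precover
`Y⁰ ⟶ A`). -/
def resolutionD (n : ℕ) : resolutionX c A (n + 1) ⟶ resolutionX c A n :=
  resolutionCover c A n ≫ resolutionIncl c A n

lemma resolutionD_comp (n : ℕ) : resolutionD c A (n + 1) ≫ resolutionD c A n = 0 := by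
  simp only [resolutionD, Category.assoc]
  rw [← Category.assoc (resolutionIncl c A (n + 1)), resolutionIncl_comp_cover, zero_comp,
    comp_zero]

/-- The cochain complex `⋯ ⟶ Y⁻¹ ⟶ Y⁰ ⟶ A ⟶ 0`, with `Y⁻ⁿ` in degree `-n` and `A` in
degree `1`. -/
def resolution : CochainComplex AddCommGrpCat.{u} ℤ :=
  (ChainComplex.of (resolutionX c A) (resolutionD c A) (resolutionD_comp c A)).extend
    (ComplexShape.embeddingUpIntLE 1)

end Resolution

/-! ### The homotopy category and the functor -/

/-- The homotopy category `K(Ab)` of cochain complexes of abelian groups. -/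
abbrev KAb : Type (u + 1) := HomotopyCategory AddCommGrpCat.{u} (ComplexShape.up ℤ)

/-- The class of all regular cardinals. -/
abbrev RegularCardinal : Type (u + 1) := {κ : Cardinal.{u} // κ.IsRegular}

/-- The abelian group `ℤ^κ`. -/
def intPower (κ : Cardinal.{u}) : AddCommGrpCat.{u} := AddCommGrpCat.of (κ.out → ℤ)

/-- The complex `Y_{ℤ^κ, κ}` as an object of `K(Ab)`. -/
def resolutionIntPower
    (c : ∀ κ : RegularCardinal.{u}, ℕ → ∀ B : AddCommGrpCat.{u}, Precover κ.1 B)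
    (κ : RegularCardinal.{u}) : KAb.{u} :=
  (HomotopyCategory.quotient AddCommGrpCat.{u} (ComplexShape.up ℤ)).obj
    (resolution (c κ) (intPower κ.1))

/-- The product `∏_κ K(Ab)(-, Y κ)` over the class of all regular cardinals; a priori it takes
values in abelian groups of the next universe. -/
def classProduct (Y : RegularCardinal.{u} → KAb.{u}) :
    KAb.{u}ᵒᵖ ⥤ AddCommGrpCat.{u + 1} where
  obj X := AddCommGrpCat.of (∀ κ : RegularCardinal.{u}, X.unop ⟶ Y κ)
  map f := AddCommGrpCat.ofHom
    { toFun := fun g κ => f.unop ≫ g κ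
      map_zero' := by funext κ; simp
      map_add' := fun g h => by funext κ; simp }
  map_id X := by ext g κ; simp
  map_comp f g := by ext h κ; simp

end KAbExample

end

/-!
Every abelian group of cardinality `μ` lies in `Ab_κ` for all `κ > μ`, whereas `ℤ^κ ∉ Ab_κ`: by
Chase's lemma, `ℤ^κ ≅ (ℤ^κ)^ℕ` is not a direct summand of a direct sum of groups of cardinality
less than `κ`. The complex `Y_{A,κ}` is bounded above and becomes exact under
`Hom(X, -)` for `X ∈ Ab_κ`, so a complex with terms in `Ab_κ` has no nonzero map to it in `K(Ab)`,
and if `Y_{A,κ}` itself is contractible, then `A` is a direct summand of `Y⁰` and lies in `Ab_κ`.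
Hence every object of `K(Ab)` has nonzero maps to only a small set of the complexes `Y_{ℤ^κ,κ}`, so
that the product `F` has small values, and for each object `z` some `Y_{ℤ^κ,κ}` is not a retract of
`z`. A generating element of `F(z)` would make every `Y_{ℤ^κ,κ}` a retract of `z`, hence `F` is not
even a quotient of a representable functor.

A cohomological functor behaves like an injective object with respect to finitely presentable
modules, so `Hom(-, F)` is exact on `A(T)`. Coproducts in `A(T)` are presented by the coproducts of
generators and relations, so `Hom(-, F)` sends them to products. Finally, a module representing
`Hom(-, F)` maps onto `F`, so that `F` would be a quotient of a representable functor.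
-/

namespace KAbExample

/-! ### Chase's lemma -/

section Chase

variable {A : ℕ → Type u} [∀ n, AddCommGroup (A n)] {J : Type v} {C : J → Type w}
  [∀ j, AddCommGroup (C j)]

lemma exists_eq_sum_range_add_nsmul {N : ℕ → ℕ} (hN : ∀ i n, i ≤ n → N i ∣ N n)
    {x : ℕ → ∀ k, A k} (hx : ∀ n, ∀ k < n, x n k = 0) :
    ∃ z : ∀ k, A k, ∀ n, ∃ y : ∀ k, A k,
      z = ∑ i ∈ Finset.range n, N i • x i + N n • y := by
  refine ⟨fun k => ∑ i ∈ Finset.range (k + 1), N i • x i k, fun n =>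
    ⟨fun k => ∑ i ∈ Finset.Ico n (k + 1), (N i / N n) • x i k, funext fun k => ?_⟩⟩
  have hsmul : N n • ∑ i ∈ Finset.Ico n (k + 1), (N i / N n) • x i k =
      ∑ i ∈ Finset.Ico n (k + 1), N i • x i k := by
    rw [Finset.smul_sum]
    refine Finset.sum_congr rfl fun i hi => ?_
    rw [smul_smul, Nat.mul_div_cancel' (hN _ _ (Finset.mem_Ico.1 hi).1)]
  simp only [Pi.add_apply, Finset.sum_apply, Pi.smul_apply, hsmul]
  rcases le_total n (k + 1) with h | h
  · rw [Finset.sum_range_add_sum_Ico _ h]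
  · rw [Finset.Ico_eq_empty_of_le h, Finset.sum_empty, add_zero]
    refine Finset.sum_subset (Finset.range_mono h) fun i _ hi => ?_
    rw [hx i k (by simpa using hi), smul_zero]

/-- An obstruction to divisibility for a homomorphism `f` from a product to a direct sum: an
element `x` of the product, vanishing in the coordinates `< start`, such that the `j`-th
coordinate of `f (N • x)` is not divisible by `M`. -/
structure DivisibilityObstruction (f : (∀ n, A n) →+ ⨁ j, C j) where
  /-- the first coordinate in which the element may be nonzero -/
  start : ℕ
  /-- the multiple of the element to be considered -/
  N : ℕ
  /-- the integer that does not divide -/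
  M : ℕ
  /-- the element -/
  x : ∀ n, A n
  /-- the coordinate in which divisibility fails -/
  j : J
  N_pos : 0 < N
  M_pos : 0 < M
  x_eq_zero : ∀ k < start, x k = 0
  ne_nsmul : ∀ y : C j, f (N • x) j ≠ M • y

variable (f : (∀ n, A n) →+ ⨁ j, C j)

/-- The diagonal step: summing the multiples `N n • x n` of a sequence of obstructions of
increasing strength would give an element whose image has infinite support. -/
lemma not_exists_seq_obstruction (o : ℕ → DivisibilityObstruction f)
    (hstart : ∀ i n, i < n → (o i).start < (o n).start)
    (hN : ∀ i n, i < n → (o i).N * (o i).M ∣ (o n).N)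
    (hj : ∀ i n, i < n → (o i).j ≠ (o n).j)
    (hf : ∀ i n, i < n → f ((o i).N • (o i).x) (o n).j = 0) : False := by
  classical
  have hdvd : ∀ i n, i ≤ n → (o i).N ∣ (o n).N := fun i n h => by
    rcases h.eq_or_lt with rfl | h
    · exact dvd_rfl
    · exact (dvd_mul_right _ _).trans (hN i n h)
  have hzero : ∀ n, ∀ k < n, (o n).x k = 0 := fun n k hk =>
    (o n).x_eq_zero k (hk.trans_le (StrictMono.le_apply (f := fun n => (o n).start) hstart))
  obtain ⟨z, hz⟩ := exists_eq_sum_range_add_nsmul hdvd hzero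
  have hfz : ∀ n, f z (o n).j ≠ 0 := by
    intro n h0
    obtain ⟨y, hy⟩ := hz (n + 1)
    obtain ⟨q, hq⟩ := hN n (n + 1) n.lt_succ_self
    have hlower : ∑ i ∈ Finset.range n, f ((o i).N • (o i).x) (o n).j = 0 :=
      Finset.sum_eq_zero fun i hi => hf i n (Finset.mem_range.1 hi)
    have hsplit : f ((o n).N • (o n).x) (o n).j + (o (n + 1)).N • f y (o n).j = 0 := by
      rw [← h0, hy, Finset.sum_range_succ, map_add, map_add, map_sum, map_nsmul f (o (n + 1)).N,
        DirectSum.add_apply, DirectSum.add_apply, DirectSum.sum_apply, hlower, zero_add]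
      rfl
    refine (o n).ne_nsmul (((o n).N * q) • -f y (o n).j) ?_
    rw [eq_neg_of_add_eq_zero_left hsplit, hq, smul_smul, smul_neg]
    ring_nf
  have hinj : Function.Injective fun n => (o n).j := fun i n h => by
    by_contra hne
    rcases lt_or_gt_of_ne hne with hlt | hlt
    · exact hj _ _ hlt h
    · exact hj _ _ hlt h.symm
  exact Set.infinite_range_of_injective hinj ((f z).support.finite_toSet.subset
    (Set.range_subset_iff.2 fun n => DFinsupp.mem_support_iff.2 (hfz n)))

lemma exists_forall_vanishing_nsmul_divisible :
    ∃ (m N : ℕ) (S : Finset J), 0 < N ∧ ∀ x : ∀ n, A n, (∀ k < m, x k = 0) →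
      ∀ j ∉ S, ∀ M : ℕ, 0 < M → ∃ y : C j, f (N • x) j = M • y := by
  classical
  by_contra! H
  obtain ⟨o, -, ho⟩ := exists_seq_of_forall_finset_exists (α := DivisibilityObstruction f)
    (fun _ => True)
    (fun a b => a.start < b.start ∧ a.N * a.M ∣ b.N ∧ a.j ≠ b.j ∧ f (a.N • a.x) b.j = 0)
    fun s _ => by
      have hN : 0 < ∏ a ∈ s, a.N * a.M :=
        Finset.prod_pos fun a _ => Nat.mul_pos a.N_pos a.M_pos
      obtain ⟨x, hx, j, hj, M, hM, hne⟩ := H (s.sup (·.start) + 1) (∏ a ∈ s, a.N * a.M)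
        (s.image (·.j) ∪ s.biUnion fun a => (f (a.N • a.x)).support) hN
      simp only [Finset.mem_union, Finset.mem_image, Finset.mem_biUnion, not_or, not_exists,
        not_and, DFinsupp.notMem_support_iff] at hj
      exact ⟨⟨_, _, M, x, j, hN, hM, hx, hne⟩, trivial, fun a ha =>
        ⟨Nat.lt_succ_of_le (Finset.le_sup (f := (·.start)) ha), Finset.dvd_prod_of_mem _ ha,
          hj.1 a ha, hj.2 a ha⟩⟩
  exact not_exists_seq_obstruction f o (fun i n h => (ho i n h).1) (fun i n h => (ho i n h).2.1)
    (fun i n h => (ho i n h).2.2.1) fun i n h => (ho i n h).2.2.2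

lemma directSum_exists_eq_nsmul {M : ℕ} {x : ⨁ j, C j} (hx : ∀ j, ∃ y, x j = M • y) :
    ∃ y, x = M • y := by
  classical
  choose y hy using hx
  refine ⟨∑ j ∈ x.support, DirectSum.of C j (y j), ?_⟩
  conv_lhs => rw [← DirectSum.sum_support_of x]
  simp only [hy, map_nsmul, Finset.smul_sum]

/-- An element of `A m` with vanishing image in the summands from `S` has a multiple that is
infinitely divisible, by Chase's lemma. -/
lemma exists_injective_pi_finset_of_leftInverse [∀ n, IsAddTorsionFree (A n)]
    (hA : ∀ n (a : A n), (∀ M : ℕ, 0 < M → ∃ b, a = M • b) → a = 0)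
    {r : (⨁ j, C j) →+ ∀ n, A n} (hr : Function.LeftInverse r f) :
    ∃ (m : ℕ) (S : Finset J) (g : A m → ∀ j : S, C j), Function.Injective g := by
  classical
  obtain ⟨m, N, S, hN, hdiv⟩ := exists_forall_vanishing_nsmul_divisible f
  let g : A m →+ ∀ j : S, C j :=
    { toFun a j := f (N • Pi.single m a) j
      map_zero' := by ext; simp
      map_add' a b := by ext; simp [Pi.single_add] }
  refine ⟨m, S, g, (injective_iff_map_eq_zero g).2 fun a ha => ?_⟩
  have hdiv' : ∀ M : ℕ, 0 < M → ∃ b, N • a = M • b := fun M hM => by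
    obtain ⟨y, hy⟩ : ∃ y, f (N • Pi.single m a) = M • y :=
      directSum_exists_eq_nsmul fun j => by
        by_cases hj : j ∈ S
        · exact ⟨0, (congrFun ha ⟨j, hj⟩).trans (smul_zero M).symm⟩
        · exact hdiv _ (fun k hk => Pi.single_eq_of_ne hk.ne a) j hj M hM
    refine ⟨r y m, ?_⟩
    have := congrFun (congrArg r hy) m
    rwa [hr, map_nsmul, Pi.smul_apply, Pi.smul_apply, Pi.single_eq_same] at this
  exact nsmul_right_injective hN.ne' ((hA m _ hdiv').trans (smul_zero N).symm)

end Chase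

lemma card_pi_lt_of_finite {κ : Cardinal.{u}} (hκ : Cardinal.aleph0 ≤ κ) {S : Type u} [Finite S]
    {C : S → Type u} (hC : ∀ j, Cardinal.mk (C j) < κ) : Cardinal.mk (∀ j, C j) < κ := by
  have := Fintype.ofFinite S
  rw [Cardinal.mk_pi, Cardinal.prod_eq_of_fintype, Cardinal.lift_id]
  exact Finset.prod_induction _ (· < κ) (fun a b ha hb => Cardinal.mul_lt_of_lt hκ ha hb)
    (Cardinal.one_lt_aleph0.trans_le hκ) fun i _ => hC i

lemma int_pi_eq_zero_of_forall_nsmul {ι : Type u} {a : ι → ℤ}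
    (ha : ∀ M : ℕ, 0 < M → ∃ b, a = M • b) : a = 0 := by
  funext i
  obtain ⟨b, hb⟩ := ha ((a i).natAbs + 1) (Nat.succ_pos _)
  have hdvd : (((a i).natAbs + 1 : ℕ) : ℤ) ∣ a i :=
    ⟨b i, by simpa using congrFun hb i⟩
  exact Int.eq_zero_of_abs_lt_dvd hdvd (by push_cast; omega)

/-! ### Groups in `AbLT κ` -/

/-- Retractions of the summands of a direct sum add up. -/
def retractDirectSum {ι : Type u} {G H : ι → AddCommGrpCat.{u}} (r : ∀ i, Retract (G i) (H i)) :
    Retract (AddCommGrpCat.of (⨁ i, G i)) (AddCommGrpCat.of (⨁ i, H i)) where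
  i := AddCommGrpCat.ofHom (DirectSum.map fun i => (r i).i.hom)
  r := AddCommGrpCat.ofHom (DirectSum.map fun i => (r i).r.hom)
  retract := by
    rw [← AddCommGrpCat.ofHom_comp, ← DirectSum.map_comp]
    simp only [← AddCommGrpCat.hom_comp, Retract.retract, AddCommGrpCat.hom_id, DirectSum.map_id]
    rfl

lemma AbLT.exists_retract {κ : Cardinal.{u}} {A : AddCommGrpCat.{u}} (hA : AbLT κ A) :
    ∃ (ι : Type u) (C : ι → AddCommGrpCat.{u}), (∀ i, Cardinal.mk (C i) < κ) ∧
      Nonempty (Retract A (AddCommGrpCat.of (⨁ i, C i))) := by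
  classical
  induction hA with
  | of_card_lt A hA =>
    exact ⟨PUnit, fun _ => A, fun _ => hA,
      ⟨.ofIso (DirectSum.id A PUnit).symm.toAddCommGrpIso⟩⟩
  | directSum ι G _ ih =>
    choose J C hC r using ih
    exact ⟨Σ i, J i, fun k => C k.1 k.2, fun k => hC _ _,
      ⟨(retractDirectSum fun i => (r i).some).trans (.ofIso (DirectSum.sigmaCurryEquiv
        (δ := fun i j => (C i j : Type u))).symm.toAddCommGrpIso)⟩⟩
  | directSummand A B s _ ih =>
    obtain ⟨J, C, hC, ⟨r⟩⟩ := ih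
    exact ⟨J, C, hC, ⟨s.trans r⟩⟩

lemma not_abLT_intPower {κ : Cardinal.{u}} (hκ : Cardinal.aleph0 ≤ κ) :
    ¬ AbLT κ (intPower κ) := by
  classical
  intro hA
  obtain ⟨J, C, hC, ⟨s⟩⟩ := hA.exists_retract
  obtain ⟨e⟩ : Nonempty (κ.out ≃ ℕ × κ.out) := Cardinal.eq.1 (by
    simp only [Cardinal.mk_prod, Cardinal.mk_out, Cardinal.mk_nat, Cardinal.lift_aleph0,
      Cardinal.lift_uzero, Cardinal.aleph0_mul_eq hκ])
  let φ : (κ.out → ℤ) ≃+ (ℕ → κ.out → ℤ) :=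
    ((LinearEquiv.funCongrLeft ℤ ℤ e.symm).trans (LinearEquiv.curry ℤ ℤ ℕ κ.out)).toAddEquiv
  obtain ⟨-, S, g, hg⟩ := exists_injective_pi_finset_of_leftInverse
    (s.i.hom.comp φ.symm.toAddMonoidHom) (fun _ _ => int_pi_eq_zero_of_forall_nsmul)
    (r := φ.toAddMonoidHom.comp s.r.hom) fun x =>
      (congrArg φ (ConcreteCategory.congr_hom s.retract (φ.symm x))).trans (φ.apply_symm_apply x)
  have hle : κ ≤ Cardinal.mk (κ.out → ℤ) := by
    conv_lhs => rw [← Cardinal.mk_out κ]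
    exact Cardinal.mk_le_of_injective (f := fun i => Pi.single i 1) fun i j h => by
      simpa [Pi.single_apply] using congrFun h i
  exact (card_pi_lt_of_finite hκ fun j : S => hC j).not_ge
    (hle.trans (Cardinal.mk_le_of_injective hg))

/-! ### Precovers -/

lemma AbLT.exists_lift {κ : Cardinal.{u}} {P A : AddCommGrpCat.{u}} {p : P ⟶ A}
    (hp : ∀ X : AddCommGrpCat.{u}, Cardinal.mk X < κ → ∀ g : X ⟶ A, ∃ h : X ⟶ P, h ≫ p = g)
    {X : AddCommGrpCat.{u}} (hX : AbLT κ X) (g : X ⟶ A) : ∃ h : X ⟶ P, h ≫ p = g := by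
  classical
  induction hX with
  | of_card_lt X hX => exact hp X hX g
  | directSum ι H _ ih =>
    choose h hh using fun i => ih i
      (AddCommGrpCat.ofHom (g.hom.comp (DirectSum.of (fun i => (H i : Type u)) i)))
    refine ⟨AddCommGrpCat.ofHom (DirectSum.toAddMonoid fun i => (h i).hom), ?_⟩
    ext1
    refine DirectSum.addHom_ext fun i y => Eq.trans ?_ (ConcreteCategory.congr_hom (hh i) y)
    exact congrArg p.hom (DirectSum.toAddMonoid_of (fun i => (h i).hom) i y)
  | directSummand X B s _ ih =>
    obtain ⟨h, hh⟩ := ih (s.r ≫ g)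
    exact ⟨s.i ≫ h, by rw [Category.assoc, hh, s.retract_assoc]⟩

lemma exists_representatives_of_card_lt (κ : Cardinal.{u}) :
    ∃ (I : Type u) (G : I → AddCommGrpCat.{u}), (∀ i, Cardinal.mk (G i) < κ) ∧
      ∀ X : AddCommGrpCat.{u}, Cardinal.mk X < κ → ∃ i, Nonempty (X ≅ G i) := by
  refine ⟨Σ s : {s : Set κ.out // Cardinal.mk s < κ}, AddCommGroup s.1,
    fun i => @AddCommGrpCat.of i.1.1 i.2, fun i => i.1.2, fun X hX => ?_⟩
  obtain ⟨ε⟩ : Nonempty (X ↪ κ.out) := by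
    have := hX.le
    rwa [← Cardinal.mk_out κ] at this
  let e : Set.range ε ≃ X := (Equiv.ofInjective ε ε.injective).symm
  let _ : AddCommGroup (Set.range ε) := e.addCommGroup
  exact ⟨⟨⟨Set.range ε, by rwa [Cardinal.mk_range_eq ε ε.injective]⟩, e.addCommGroup⟩,
    ⟨e.addEquiv.symm.toAddCommGrpIso⟩⟩

lemma nonempty_precover (κ : Cardinal.{u}) (A : AddCommGrpCat.{u}) :
    Nonempty (Precover κ A) := by
  classical
  obtain ⟨I, G, hG, hI⟩ := exists_representatives_of_card_lt κ
  let φ : ∀ i : Σ i, (G i ⟶ A), G i.1 →+ A := fun i => i.2.hom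
  refine ⟨⟨AddCommGrpCat.of (⨁ i : Σ i, (G i ⟶ A), G i.1),
    .directSum _ _ fun i => .of_card_lt _ (hG i.1),
    AddCommGrpCat.ofHom (DirectSum.toAddMonoid φ), fun X => AbLT.exists_lift ?_⟩⟩
  intro X hX g
  obtain ⟨i, ⟨e⟩⟩ := hI X hX
  refine ⟨e.hom ≫ AddCommGrpCat.ofHom
    (DirectSum.of (fun i : Σ i, (G i ⟶ A) => (G i.1 : Type u)) ⟨i, e.inv ≫ g⟩), ?_⟩
  rw [Category.assoc, ← Iso.eq_inv_comp]
  ext x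
  exact DirectSum.toAddMonoid_of φ ⟨i, e.inv ≫ g⟩ x

/-! ### Morphisms into bounded above complexes -/

section NullHomotopy

open CochainComplex HomComplex

variable {C : Type w} [Category.{v} C] [Preadditive C] {X Y : CochainComplex C ℤ} {f : X ⟶ Y}

/-- The cochain `z` of degree `-1` is a null homotopy of `f` in all degrees `> n`. -/
def IsNullHomotopyAbove (f : X ⟶ Y) (n : ℤ) (z : Cochain X Y (-1)) : Prop :=
  ∀ p, n < p → (δ (-1) 0 z).v p p (add_zero p) = f.f p

lemma delta_neg_one_v (z : Cochain X Y (-1)) (p : ℤ) :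
    (δ (-1) 0 z).v p p (add_zero p) = z.v p (p - 1) (by lia) ≫ Y.d (p - 1) p +
      X.d p (p + 1) ≫ z.v (p + 1) p (by lia) := by
  rw [δ_v (-1) 0 (by lia) z p p (add_zero p) (p - 1) (p + 1) rfl rfl, Int.negOnePow_zero, one_smul]

/-- Since `f - δ z` is a cocycle which vanishes in degree `n + 1`, its component in degree `n`
is killed by the differential of `Y`. -/
lemma IsNullHomotopyAbove.sub_comp_d {n : ℤ} {z : Cochain X Y (-1)}
    (hz : IsNullHomotopyAbove f n z) :
    (f.f n - (δ (-1) 0 z).v n n (add_zero n)) ≫ Y.d n (n + 1) = 0 := by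
  have hδ : δ 0 1 (Cochain.ofHom f - δ (-1) 0 z) = 0 := by
    rw [δ_sub, δ_ofHom, δ_δ, sub_zero]
  have hv := Cochain.congr_v hδ n (n + 1) rfl
  rw [δ_v 0 1 (zero_add 1) _ n (n + 1) rfl n (n + 1) (by lia) rfl] at hv
  simpa [hz (n + 1) (lt_add_one n)] using hv

lemma IsNullHomotopyAbove.exists_extend {n : ℤ} {z : Cochain X Y (-1)}
    (hz : IsNullHomotopyAbove f n z)
    (hXY : ∀ g : X.X n ⟶ Y.X n, g ≫ Y.d n (n + 1) = 0 →
      ∃ h : X.X n ⟶ Y.X (n - 1), h ≫ Y.d (n - 1) n = g) :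
    ∃ z' : Cochain X Y (-1), IsNullHomotopyAbove f (n - 1) z' ∧
      ∀ (p q : ℤ) (hpq : p + (-1) = q), n < p → z'.v p q hpq = z.v p q hpq := by
  obtain ⟨h, hh⟩ := hXY _ hz.sub_comp_d
  have hne : ∀ (p q : ℤ) (hpq : p + (-1) = q), n < p →
      (z + Cochain.single h (-1)).v p q hpq = z.v p q hpq := fun p q hpq hp => by
    rw [Cochain.add_v, Cochain.single_v_eq_zero h (-1) p q hpq hp.ne', add_zero]
  refine ⟨z + Cochain.single h (-1), fun p hp => ?_, hne⟩
  rw [delta_neg_one_v, hne (p + 1) p _ (by omega)]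
  obtain rfl | hlt := (show n ≤ p by omega).eq_or_lt
  · rw [Cochain.add_v, Cochain.single_v, Preadditive.add_comp, hh, delta_neg_one_v]
    abel
  · rw [hne p (p - 1) _ hlt, ← delta_neg_one_v]
    exact hz p hlt

lemma exists_delta_eq_of_seq {b : ℤ} {z : ℕ → Cochain X Y (-1)}
    (hz : ∀ k : ℕ, IsNullHomotopyAbove f (b - k) (z k))
    (hsucc : ∀ (k : ℕ) (p q : ℤ) (hpq : p + (-1) = q), b - k < p →
      (z (k + 1)).v p q hpq = (z k).v p q hpq) :
    ∃ y : Cochain X Y (-1), δ (-1) 0 y = Cochain.ofHom f := by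
  have hle : ∀ (k l : ℕ) (p q : ℤ) (hpq : p + (-1) = q), k ≤ l → b - k < p →
      (z l).v p q hpq = (z k).v p q hpq := by
    intro k l p q hpq hkl hp
    induction l, hkl using Nat.le_induction with
    | base => rfl
    | succ l hl ih => exact (hsucc l p q hpq (by omega)).trans ih
  refine ⟨Cochain.mk fun p q hpq => (z (b + 1 - p).toNat).v p q hpq, ?_⟩
  ext p
  rw [Cochain.ofHom_v, ← hz (b + 1 - p).toNat p (by omega), delta_neg_one_v, delta_neg_one_v,
    hle (b + 1 - (p + 1)).toNat (b + 1 - p).toNat (p + 1) p (by omega) (by omega) (by omega)]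
  rfl

/-- A null homotopy is constructed by descending induction on the degree. -/
lemma nonempty_homotopy_zero (b : ℤ) (hb : ∀ m, b < m → IsZero (Y.X m))
    (hXY : ∀ (m : ℤ) (g : X.X m ⟶ Y.X m), g ≫ Y.d m (m + 1) = 0 →
      ∃ h : X.X m ⟶ Y.X (m - 1), h ≫ Y.d (m - 1) m = g)
    (f : X ⟶ Y) : Nonempty (Homotopy f 0) := by
  have hstep : ∀ (k : ℕ) (z : {z // IsNullHomotopyAbove f (b - k) z}),
      ∃ z' : {z // IsNullHomotopyAbove f (b - (k + 1 : ℕ)) z},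
        ∀ (p q : ℤ) (hpq : p + (-1) = q), b - k < p → z'.1.v p q hpq = z.1.v p q hpq :=
    fun k z => by
      obtain ⟨z', hz', h⟩ := z.2.exists_extend (hXY _)
      exact ⟨⟨z', by simpa [sub_sub] using hz'⟩, h⟩
  choose φ hφ using hstep
  let z : ∀ k : ℕ, {z // IsNullHomotopyAbove f (b - k) z} := fun k =>
    Nat.rec ⟨0, fun p hp => (hb p (by simpa using hp)).eq_of_tgt _ _⟩ φ k
  obtain ⟨y, hy⟩ := exists_delta_eq_of_seq (fun k => (z k).2) fun k => hφ k (z k)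
  exact ⟨(Cochain.equivHomotopy f 0).symm ⟨y, by rw [hy, Cochain.ofHom_zero, add_zero]⟩⟩

end NullHomotopy

/-! ### The relative resolutions -/

section Resolution

variable {κ : Cardinal.{u}} (c : ℕ → ∀ B : AddCommGrpCat.{u}, Precover κ B)
  (A : AddCommGrpCat.{u})

instance mono_resolutionIncl (n : ℕ) : Mono (resolutionIncl c A n) := by
  cases n with
  | zero => exact inferInstanceAs (Mono (𝟙 A))
  | succ n => exact inferInstanceAs (Mono (kernel.ι (c n (syzygy c A n)).map))

variable {A} in
lemma AbLT.exists_lift_resolutionCover {X : AddCommGrpCat.{u}} (hX : AbLT κ X) {n : ℕ}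
    (g : X ⟶ syzygy c A n) : ∃ h : X ⟶ resolutionX c A (n + 1), h ≫ resolutionCover c A n = g :=
  (c n (syzygy c A n)).exists_lift X hX g

variable {A} in
lemma AbLT.exists_lift_resolutionD {X : AddCommGrpCat.{u}} (hX : AbLT κ X) {n : ℕ}
    {g : X ⟶ resolutionX c A (n + 1)} (hg : g ≫ resolutionD c A n = 0) :
    ∃ h : X ⟶ resolutionX c A (n + 2), h ≫ resolutionD c A (n + 1) = g := by
  have hcover : g ≫ resolutionCover c A n = 0 := by
    rwa [← cancel_mono (resolutionIncl c A n), Category.assoc, zero_comp]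
  obtain ⟨h, hh⟩ := hX.exists_lift_resolutionCover c (n := n + 1)
    (kernel.lift (c n (syzygy c A n)).map g hcover)
  refine ⟨h, ?_⟩
  rw [resolutionD, reassoc_of% hh]
  exact kernel.lift_ι _ _ _

variable {A} in
lemma AbLT.exists_lift_resolutionD_zero {X : AddCommGrpCat.{u}} (hX : AbLT κ X)
    (g : X ⟶ resolutionX c A 0) : ∃ h : X ⟶ resolutionX c A 1, h ≫ resolutionD c A 0 = g := by
  obtain ⟨h, hh⟩ := hX.exists_lift_resolutionCover c (n := 0) g
  refine ⟨h, ?_⟩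
  rw [resolutionD, reassoc_of% hh]
  exact Category.comp_id g

/-- The term of the resolution in degree `m = 1 - n` is `A` for `n = 0` and `Y⁻⁽ⁿ⁻¹⁾` for
`n > 0`. -/
noncomputable def resolutionXIso {m : ℤ} (n : ℕ) (h : 1 - (n : ℤ) = m) :
    (resolution c A).X m ≅ resolutionX c A n :=
  HomologicalComplex.extendXIso _ (ComplexShape.embeddingUpIntLE 1) h

lemma resolution_d_eq {m m' : ℤ} (n : ℕ) (h : 1 - ((n + 1 : ℕ) : ℤ) = m)
    (h' : 1 - (n : ℤ) = m') :
    (resolution c A).d m m' = (resolutionXIso c A (n + 1) h).hom ≫ resolutionD c A n ≫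
      (resolutionXIso c A n h').inv := by
  rw [← ChainComplex.of_d (resolutionX c A) (resolutionD c A) n]
  exact HomologicalComplex.extend_d_eq _ (ComplexShape.embeddingUpIntLE 1) h h'

lemma isZero_resolution_X (m : ℤ) (hm : 1 < m) : IsZero ((resolution c A).X m) :=
  HomologicalComplex.isZero_extend_X _ _ _
    ((ComplexShape.notMem_range_embeddingUpIntLE_iff 1 m).2 hm)

variable {A} in
lemma AbLT.exists_lift_resolution_d {X : AddCommGrpCat.{u}} (hX : AbLT κ X) (m : ℤ)
    (g : X ⟶ (resolution c A).X m) (hg : g ≫ (resolution c A).d m (m + 1) = 0) :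
    ∃ h : X ⟶ (resolution c A).X (m - 1), h ≫ (resolution c A).d (m - 1) m = g := by
  by_cases hm : 1 < m
  · exact ⟨0, (isZero_resolution_X c A m hm).eq_of_tgt _ _⟩
  obtain ⟨n, hn⟩ : ∃ n : ℕ, 1 - (n : ℤ) = m := ⟨(1 - m).toNat, by lia⟩
  obtain ⟨h, hh⟩ : ∃ h : X ⟶ resolutionX c A (n + 1),
      h ≫ resolutionD c A n = g ≫ (resolutionXIso c A n hn).hom := by
    cases n with
    | zero => exact hX.exists_lift_resolutionD_zero c _
    | succ n =>
      refine hX.exists_lift_resolutionD c ?_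
      rw [resolution_d_eq c A n hn (by lia)] at hg
      rwa [← cancel_mono (resolutionXIso c A n (m := m + 1) (by lia)).inv, Category.assoc,
        Category.assoc, zero_comp]
  refine ⟨h ≫ (resolutionXIso c A (n + 1) (by lia)).inv, ?_⟩
  rw [resolution_d_eq c A n (by lia) hn, Category.assoc, Iso.inv_hom_id_assoc, reassoc_of% hh,
    Iso.hom_inv_id, Category.comp_id]

lemma hom_resolution_eq_zero {X : KAb.{u}} (hX : ∀ m, AbLT κ (X.as.X m))
    (f : X ⟶ (HomotopyCategory.quotient AddCommGrpCat.{u} (ComplexShape.up ℤ)).obj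
      (resolution c A)) : f = 0 := by
  obtain ⟨X, rfl⟩ := HomotopyCategory.quotient_obj_surjective X
  obtain ⟨f, rfl⟩ := (HomotopyCategory.quotient _ _).map_surjective f
  rw [HomotopyCategory.quotient_map_eq_zero_iff]
  exact nonempty_homotopy_zero 1 (isZero_resolution_X c A)
    (fun m => (hX m).exists_lift_resolution_d c m) f

variable {A} in
/-- In degree `1`, a contraction of the resolution is a section of the precover `Y⁰ ⟶ A`. -/
lemma abLT_of_id_resolution_eq_zero
    (h : 𝟙 ((HomotopyCategory.quotient AddCommGrpCat.{u} (ComplexShape.up ℤ)).obj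
      (resolution c A)) = 0) : AbLT κ A := by
  rw [← CategoryTheory.Functor.map_id, HomotopyCategory.quotient_map_eq_zero_iff] at h
  obtain ⟨s⟩ := h
  let e := resolutionXIso c A 0 (m := 1) (by lia)
  have hs : s.hom 1 0 ≫ (resolutionXIso c A 1 (by lia)).hom ≫ resolutionD c A 0 ≫ e.inv =
      𝟙 _ := by
    have hcomm := s.comm 1
    rw [dNext_eq s.hom (show (ComplexShape.up ℤ).Rel 1 2 by simp),
      prevD_eq s.hom (show (ComplexShape.up ℤ).Rel 0 1 by simp),
      (isZero_resolution_X c A 2 (by lia)).eq_of_src (s.hom 2 1) 0, comp_zero, zero_add,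
      HomologicalComplex.zero_f, add_zero, HomologicalComplex.id_f,
      resolution_d_eq c A 0 (by lia) (by lia)] at hcomm
    exact hcomm.symm
  have hsection : (e.inv ≫ s.hom 1 0 ≫ (resolutionXIso c A 1 (by lia)).hom) ≫
      resolutionD c A 0 = 𝟙 _ := by
    rw [← cancel_mono e.inv, Category.id_comp, Category.assoc, Category.assoc, Category.assoc, hs,
      Category.comp_id]
  exact .directSummand A _ ⟨_, _, hsection⟩ (c 0 (syzygy c A 0)).mem

end Resolution

lemma exists_forall_abLT (X : KAb.{u}) :
    ∃ μ : Cardinal.{u}, ∀ κ, μ < κ → ∀ m, AbLT κ (X.as.X m) := by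
  refine ⟨⨆ m : ULift.{u} ℤ, Cardinal.mk (X.as.X m.down), fun κ hκ m => .of_card_lt _ ?_⟩
  exact (le_ciSup (f := fun m : ULift.{u} ℤ => Cardinal.mk (X.as.X m.down))
    Cardinal.bddAbove_of_small ⟨m⟩).trans_lt hκ

/-! ### Coproducts in the homotopy category -/

section Coproducts

variable {V : Type w} [Category.{v} V] [Preadditive V] {ι : Type*} {c : ComplexShape ι}
  {J : Type u} {X : J → HomologicalComplex V c}

/-- A morphism from a degreewise coproduct is null-homotopic if all its components are: the
homotopies are combined by the universal property in each degree. -/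
noncomputable def homotopyZeroOfCofan {t : Cofan X}
    (ht : ∀ i, IsColimit ((HomologicalComplex.eval V c i).mapCocone t))
    {Z : HomologicalComplex V c} (f : t.pt ⟶ Z) (h : ∀ j, Homotopy (t.inj j ≫ f) 0) :
    Homotopy f 0 :=
  have hom_ext : ∀ (i : ι) {W : V} (a b : t.pt.X i ⟶ W),
      (∀ j, (t.inj j).f i ≫ a = (t.inj j).f i ≫ b) → a = b := fun i W a b hab =>
    (ht i).hom_ext fun ⟨j⟩ => hab j
  let s : ∀ i k, t.pt.X i ⟶ Z.X k := fun i k =>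
    (ht i).desc ⟨Z.X k, Discrete.natTrans fun ⟨j⟩ => (h j).hom i k⟩
  have inj_comp : ∀ i k j, (t.inj j).f i ≫ s i k = (h j).hom i k := fun i k j =>
    (ht i).fac ⟨Z.X k, Discrete.natTrans fun ⟨j⟩ => (h j).hom i k⟩ ⟨j⟩
  { hom := s
    zero := fun i k hik => hom_ext i _ _ fun j => by rw [inj_comp, (h j).zero i k hik, comp_zero]
    comm := fun i => hom_ext i _ _ fun j => by
      have hcomm := (h j).comm i
      have hhom : (h j).hom = fun i k => (t.inj j).f i ≫ s i k := by
        funext i k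
        exact (inj_comp i k j).symm
      rw [hhom, dNext_comp_left, prevD_comp_left] at hcomm
      simpa only [Preadditive.comp_add, HomologicalComplex.zero_f, comp_zero,
        HomologicalComplex.comp_f] using hcomm }

lemma exists_quotient_map_inj_comp_eq {t : Cofan X} (ht : IsColimit t) {S : HomotopyCategory V c}
    (g : ∀ j, (HomotopyCategory.quotient V c).obj (X j) ⟶ S) :
    ∃ m : (HomotopyCategory.quotient V c).obj t.pt ⟶ S,
      ∀ j, (HomotopyCategory.quotient V c).map (t.inj j) ≫ m = g j := by
  obtain ⟨S, rfl⟩ := HomotopyCategory.quotient_obj_surjective S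
  choose g' hg' using fun j => (HomotopyCategory.quotient V c).map_surjective (g j)
  refine ⟨(HomotopyCategory.quotient V c).map (Cofan.IsColimit.desc ht g'), fun j => ?_⟩
  rw [← Functor.map_comp, Cofan.IsColimit.fac, hg']

variable [∀ i, PreservesColimitsOfShape (Discrete J) (HomologicalComplex.eval V c i)]

lemma eq_zero_of_quotient_map_inj_comp {t : Cofan X} (ht : IsColimit t)
    {S : HomotopyCategory V c} {m : (HomotopyCategory.quotient V c).obj t.pt ⟶ S}
    (hm : ∀ j, (HomotopyCategory.quotient V c).map (t.inj j) ≫ m = 0) : m = 0 := by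
  obtain ⟨S, rfl⟩ := HomotopyCategory.quotient_obj_surjective S
  obtain ⟨m, rfl⟩ := (HomotopyCategory.quotient V c).map_surjective m
  simp only [← Functor.map_comp, HomotopyCategory.quotient_map_eq_zero_iff] at hm ⊢
  exact ⟨homotopyZeroOfCofan (fun i => isColimitOfPreserves _ ht) m fun j => (hm j).some⟩

lemma nonempty_isColimit_quotient_cofan {t : Cofan X} (ht : IsColimit t) :
    Nonempty (IsColimit (Cofan.mk ((HomotopyCategory.quotient V c).obj t.pt) fun j =>
      (HomotopyCategory.quotient V c).map (t.inj j))) := by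
  choose desc fac using fun s : Cofan fun j => (HomotopyCategory.quotient V c).obj (X j) =>
    exists_quotient_map_inj_comp_eq ht s.inj
  refine ⟨Cofan.IsColimit.mk _ desc fac fun s m hm => sub_eq_zero.1
    (eq_zero_of_quotient_map_inj_comp ht fun j => ?_)⟩
  exact (Preadditive.comp_sub _ _ _).trans (sub_eq_zero.2 ((hm j).trans (fac s j).symm))

instance hasCoproducts_homotopyCategory [HasCoproducts.{u} V] :
    HasCoproducts.{u} (HomotopyCategory V c) :=
  hasCoproducts_of_colimit_cofans
    (fun X => Cofan.mk _ fun j =>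
      (HomotopyCategory.quotient V c).map (Sigma.ι (fun j => (X j).as) j))
    fun X => (nonempty_isColimit_quotient_cofan
      (coproductIsCoproduct fun j => (X j).as)).some

end Coproducts

/-! ### Exactness in functor categories -/

section FunctorCategory

variable {T : Type w} [Category.{v} T] {X Y : Tᵒᵖ ⥤ AddCommGrpCat.{v}}

lemma exact_of_exact_evaluation {C : Type*} [Category* C] {D : Type*} [Category* D] [Abelian D]
    {S : ShortComplex (C ⥤ D)} (h : ∀ t, (S.map ((evaluation C D).obj t)).Exact) : S.Exact := by
  rw [ShortComplex.exact_iff_isZero_homology]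
  refine Functor.isZero _ fun t => ?_
  exact ((ShortComplex.exact_iff_isZero_homology _).1 (h t)).of_iso
    (S.mapHomologyIso ((evaluation C D).obj t)).symm

lemma exact_iff_app {S : ShortComplex (Tᵒᵖ ⥤ AddCommGrpCat.{v})} :
    S.Exact ↔ ∀ (t : T) (a : S.X₂.obj (op t)), S.g.app (op t) a = 0 →
      ∃ b : S.X₁.obj (op t), S.f.app (op t) b = a := by
  refine ⟨fun h t => ?_, fun h => exact_of_exact_evaluation fun t => ?_⟩
  · exact (ShortComplex.ab_exact_iff _).1 (h.map ((evaluation Tᵒᵖ AddCommGrpCat.{v}).obj (op t)))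
  · exact (ShortComplex.ab_exact_iff _).2 (h t.unop)

lemma epi_iff_surjective_app {q : X ⟶ Y} :
    Epi q ↔ ∀ t : T, Function.Surjective (q.app (op t)) := by
  simp only [NatTrans.epi_iff_epi_app, AddCommGrpCat.epi_iff_surjective]
  exact ⟨fun h t => h (op t), fun h t => h t.unop⟩

lemma mono_iff_injective_app {q : X ⟶ Y} :
    Mono q ↔ ∀ t : T, Function.Injective (q.app (op t)) := by
  simp only [NatTrans.mono_iff_mono_app, AddCommGrpCat.mono_iff_injective]
  exact ⟨fun h t => h (op t), fun h t => h t.unop⟩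

lemma biprod_app_ext {t : T} {a b : (X ⊞ Y).obj (op t)}
    (h₁ : (biprod.fst : X ⊞ Y ⟶ X).app (op t) a = (biprod.fst : X ⊞ Y ⟶ X).app (op t) b)
    (h₂ : (biprod.snd : X ⊞ Y ⟶ Y).app (op t) a = (biprod.snd : X ⊞ Y ⟶ Y).app (op t) b) :
    a = b := by
  have total (a : (X ⊞ Y).obj (op t)) :
      (biprod.inl : X ⟶ X ⊞ Y).app (op t) ((biprod.fst : X ⊞ Y ⟶ X).app (op t) a) +
      (biprod.inr : Y ⟶ X ⊞ Y).app (op t) ((biprod.snd : X ⊞ Y ⟶ Y).app (op t) a) = a :=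
    ConcreteCategory.congr_hom (NatTrans.congr_app (biprod.total (X := X) (Y := Y)) (op t)) a
  rw [← total a, ← total b, h₁, h₂]

lemma exists_biprod_app_eq {t : T} (a : X.obj (op t)) (b : Y.obj (op t)) :
    ∃ c : (X ⊞ Y).obj (op t), (biprod.fst : X ⊞ Y ⟶ X).app (op t) c = a ∧
      (biprod.snd : X ⊞ Y ⟶ Y).app (op t) c = b := by
  have app_comp {Z W : Tᵒᵖ ⥤ AddCommGrpCat.{v}} {f : Z ⟶ X ⊞ Y} {g : X ⊞ Y ⟶ W} {h : Z ⟶ W}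
      (w : f ≫ g = h) (z : Z.obj (op t)) : g.app (op t) (f.app (op t) z) = h.app (op t) z :=
    ConcreteCategory.congr_hom (NatTrans.congr_app w (op t)) z
  refine ⟨(biprod.inl : X ⟶ X ⊞ Y).app _ a + (biprod.inr : Y ⟶ X ⊞ Y).app _ b, ?_, ?_⟩
  · rw [map_add, app_comp biprod.inl_fst, app_comp biprod.inr_fst]
    exact add_zero a
  · rw [map_add, app_comp biprod.inl_snd, app_comp biprod.inr_snd]
    exact zero_add b

end FunctorCategory

section AdditiveFunctor

variable {T : Type w} [Category.{v} T] [Preadditive T] (G : Tᵒᵖ ⥤ AddCommGrpCat.{u}) [G.Additive]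
  {t x : T} (γ : G.obj (op x))

lemma map_op_zero_apply : G.map (0 : t ⟶ x).op γ = 0 := by
  rw [op_zero, Functor.map_zero]
  rfl

lemma map_op_add_apply (s s' : t ⟶ x) : G.map (s + s').op γ = G.map s.op γ + G.map s'.op γ := by
  rw [op_add, Functor.map_add]
  rfl

lemma map_op_sub_apply (s s' : t ⟶ x) : G.map (s - s').op γ = G.map s.op γ - G.map s'.op γ := by
  rw [op_sub, Functor.map_sub]
  rfl

end AdditiveFunctor

/-! ### Presentations -/

section Presentations

variable {T : Type w} [Category.{v} T] [Preadditive T]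

/-- A presentation `T(-, y) ⟶ T(-, x) ⟶ X ⟶ 0` of a `T`-module in terms of elements: by the
Yoneda lemma it consists of a morphism `rel : y ⟶ x` and an element `gen` of `X(x)`. -/
structure Presentation (X : Tᵒᵖ ⥤ AddCommGrpCat.{v}) where
  /-- the object representing the generators -/
  x : T
  /-- the object representing the relations -/
  y : T
  /-- the relations -/
  rel : y ⟶ x
  /-- the universal generator -/
  gen : X.obj (op x)
  map_add_gen : ∀ {t : T} (s s' : t ⟶ x),
    X.map (s + s').op gen = X.map s.op gen + X.map s'.op gen
  exists_map_gen_eq : ∀ {t : T} (a : X.obj (op t)), ∃ s : t ⟶ x, X.map s.op gen = a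
  map_gen_eq_zero_iff : ∀ {t : T} (s : t ⟶ x),
    X.map s.op gen = 0 ↔ ∃ k : t ⟶ y, k ≫ rel = s

namespace Presentation

variable {X : Tᵒᵖ ⥤ AddCommGrpCat.{v}} (P : Presentation X)

include P in
lemma additive : X.Additive where
  map_add {t t' f f'} := by
    ext a
    obtain ⟨s, rfl⟩ := P.exists_map_gen_eq a
    have := P.map_add_gen (f.unop ≫ s) (f'.unop ≫ s)
    rw [← Preadditive.add_comp] at this
    simp only [op_comp, Functor.map_comp_apply] at this
    exact this

lemma map_gen_eq_iff {t : T} {s s' : t ⟶ P.x} :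
    X.map s.op P.gen = X.map s'.op P.gen ↔ ∃ k : t ⟶ P.y, k ≫ P.rel = s - s' := by
  have := P.additive
  rw [← P.map_gen_eq_zero_iff, map_op_sub_apply, sub_eq_zero]

lemma map_rel_gen : X.map P.rel.op P.gen = 0 :=
  (P.map_gen_eq_zero_iff _).2 ⟨𝟙 _, Category.id_comp _⟩

lemma hom_ext {G : Tᵒᵖ ⥤ AddCommGrpCat.{v}} {a b : X ⟶ G}
    (h : a.app (op P.x) P.gen = b.app (op P.x) P.gen) : a = b := by
  ext ⟨t⟩ ξ
  obtain ⟨s, rfl⟩ := P.exists_map_gen_eq ξ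
  exact (NatTrans.naturality_apply a s.op P.gen).trans
    ((congrArg (G.map s.op) h).trans (NatTrans.naturality_apply b s.op P.gen).symm)

lemma exists_desc {G : Tᵒᵖ ⥤ AddCommGrpCat.{v}} [G.Additive] (γ : G.obj (op P.x))
    (hγ : G.map P.rel.op γ = 0) : ∃ η : X ⟶ G, η.app (op P.x) P.gen = γ := by
  choose σ hσ using fun {t : T} (a : X.obj (op t)) => P.exists_map_gen_eq a
  have well_defined : ∀ {t : T} {s s' : t ⟶ P.x}, X.map s.op P.gen = X.map s'.op P.gen →
      G.map s.op γ = G.map s'.op γ := fun h => by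
    obtain ⟨k, hk⟩ := P.map_gen_eq_iff.1 h
    rw [← sub_eq_zero, ← map_op_sub_apply, ← hk, op_comp, Functor.map_comp_apply, hγ, map_zero]
  refine ⟨{ app := fun t => AddCommGrpCat.ofHom (AddMonoidHom.mk' (fun a => G.map (σ a).op γ)
              fun a b => ?_)
            naturality := fun t t' f => ?_ }, ?_⟩
  · rw [← map_op_add_apply]
    exact well_defined (by rw [P.map_add_gen, hσ, hσ, hσ])
  · ext a
    refine (well_defined (s' := f.unop ≫ σ a) ?_).trans ?_
    · rw [hσ, op_comp, Functor.map_comp_apply, hσ]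
      rfl
    · rw [op_comp, Functor.map_comp_apply]
      rfl
  · refine (well_defined (s' := 𝟙 P.x) ?_).trans ?_
    · rw [hσ, op_id, Functor.map_id_apply]
    · rw [op_id, Functor.map_id_apply]

/-- The presentation given by an exact sequence `T(-, y) ⟶ T(-, x) ⟶ X ⟶ 0`. -/
def ofExact {x y : T} {f : y ⟶ x} {p : preadditiveYoneda.obj x ⟶ X}
    {hfp : preadditiveYoneda.map f ≫ p = 0} (hex : (ShortComplex.mk _ p hfp).Exact)
    (hp : Epi p) : Presentation X :=
  have map_gen : ∀ {t : T} (s : t ⟶ x), X.map s.op (p.app (op x) (𝟙 x)) = p.app (op t) s :=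
    fun {t} s => (NatTrans.naturality_apply p s.op (𝟙 x)).symm.trans
      (congrArg (p.app (op t)) (Category.comp_id s))
  { x := x
    y := y
    rel := f
    gen := p.app (op x) (𝟙 x)
    map_add_gen := fun s s' => by
      simp only [map_gen]
      exact map_add (p.app _).hom s s'
    exists_map_gen_eq := fun {t} a => by
      simp only [map_gen]
      exact epi_iff_surjective_app.1 hp t a
    map_gen_eq_zero_iff := fun {t} s => by
      rw [map_gen]
      refine ⟨exact_iff_app.1 hex t s, ?_⟩
      rintro ⟨k, rfl⟩
      exact ConcreteCategory.congr_hom (NatTrans.congr_app hfp (op t)) k }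

/-- The presentation of the cokernel of `T(-, y) ⟶ T(-, x)`. -/
noncomputable def ofHom {x y : T} (f : y ⟶ x) :
    Presentation (cokernel (preadditiveYoneda.map f)) :=
  ofExact (ShortComplex.exact_cokernel (preadditiveYoneda.map f)) inferInstance

/-- Presentations are transported along isomorphisms. -/
def ofIso {Y : Tᵒᵖ ⥤ AddCommGrpCat.{v}} (e : X ≅ Y) : Presentation Y where
  x := P.x
  y := P.y
  rel := P.rel
  gen := e.hom.app _ P.gen
  map_add_gen s s' := by
    simp only [← NatTrans.naturality_apply, P.map_add_gen, map_add]
  exists_map_gen_eq {t} a := by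
    obtain ⟨b, rfl⟩ := epi_iff_surjective_app.1 (inferInstance : Epi e.hom) t a
    obtain ⟨s, rfl⟩ := P.exists_map_gen_eq b
    exact ⟨s, (NatTrans.naturality_apply e.hom s.op P.gen).symm⟩
  map_gen_eq_zero_iff {t} s := by
    rw [← P.map_gen_eq_zero_iff, ← NatTrans.naturality_apply]
    exact map_eq_zero_iff (e.hom.app (op t)).hom
      (mono_iff_injective_app.1 (inferInstance : Mono e.hom) t)

/-- The presentation of a representable module. -/
def yoneda (x : T) : Presentation (preadditiveYoneda.obj x) where
  x := x
  y := x
  rel := 0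
  gen := 𝟙 x
  map_add_gen s s' := Preadditive.add_comp _ _ _ s s' (𝟙 x)
  exists_map_gen_eq a := ⟨a, Category.comp_id a⟩
  map_gen_eq_zero_iff {t} s := by
    simp only [comp_zero, exists_const]
    exact (Eq.congr_left (Category.comp_id s)).trans eq_comm

lemma exists_cover : ∃ p : preadditiveYoneda.obj P.x ⟶ X,
    ∀ {t : T} (s : t ⟶ P.x), p.app (op t) s = X.map s.op P.gen := by
  have := P.additive
  obtain ⟨p, hp⟩ := (yoneda P.x).exists_desc P.gen (map_op_zero_apply X P.gen)
  refine ⟨p, fun {t} s => ?_⟩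
  rw [← hp]
  exact (congrArg (p.app (op t)) (Category.comp_id s).symm).trans
    (NatTrans.naturality_apply p s.op (𝟙 P.x))

section Biproducts

variable [HasBinaryBiproducts T] {Y : Tᵒᵖ ⥤ AddCommGrpCat.{v}} (Q : Presentation Y)

include P Q

lemma nonempty_cokernel (f : X ⟶ Y) :
    Nonempty (Presentation (cokernel f)) := by
  have := Q.additive
  obtain ⟨v, hv⟩ := Q.exists_map_gen_eq (f.app _ P.gen)
  have app_map_gen {t : T} (r : t ⟶ P.x) :
      f.app (op t) (X.map r.op P.gen) = Y.map (r ≫ v).op Q.gen := by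
    rw [NatTrans.naturality_apply, ← hv, op_comp, Functor.map_comp_apply]
  have π_app_eq_zero_iff {t : T} (a : Y.obj (op t)) :
      (cokernel.π f).app (op t) a = 0 ↔ ∃ b, f.app (op t) b = a := by
    refine ⟨exact_iff_app.1 (ShortComplex.exact_cokernel f) t a, ?_⟩
    rintro ⟨b, rfl⟩
    exact ConcreteCategory.congr_hom (NatTrans.congr_app (cokernel.condition f) (op t)) b
  refine ⟨{
    x := Q.x
    y := P.x ⊞ Q.y
    rel := biprod.desc v Q.rel
    gen := (cokernel.π f).app _ Q.gen
    map_add_gen := fun s s' => by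
      simp only [← NatTrans.naturality_apply, Q.map_add_gen, map_add]
    exists_map_gen_eq := fun {t} a => ?_
    map_gen_eq_zero_iff := fun {t} s => ?_ }⟩
  · obtain ⟨b, rfl⟩ := epi_iff_surjective_app.1 (inferInstance : Epi (cokernel.π f)) t a
    obtain ⟨s, rfl⟩ := Q.exists_map_gen_eq b
    exact ⟨s, (NatTrans.naturality_apply _ _ _).symm⟩
  · rw [← NatTrans.naturality_apply, π_app_eq_zero_iff]
    constructor
    · rintro ⟨b, hb⟩
      obtain ⟨r, rfl⟩ := P.exists_map_gen_eq b
      obtain ⟨l, hl⟩ := Q.map_gen_eq_iff.1 (hb.symm.trans (app_map_gen r))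
      exact ⟨biprod.lift r l, by rw [biprod.lift_desc, hl, add_sub_cancel]⟩
    · rintro ⟨k, rfl⟩
      refine ⟨X.map (k ≫ biprod.fst).op P.gen, (app_map_gen _).trans (Q.map_gen_eq_iff.2 ?_)⟩
      exact ⟨-(k ≫ biprod.snd), by simp [biprod.desc_eq]⟩

lemma nonempty_biprod : Nonempty (Presentation (X ⊞ Y)) := by
  have := P.additive
  have := Q.additive
  obtain ⟨γ, hγ₁, hγ₂⟩ := exists_biprod_app_eq (X.map (biprod.fst : P.x ⊞ Q.x ⟶ P.x).op P.gen)
    (Y.map (biprod.snd : P.x ⊞ Q.x ⟶ Q.x).op Q.gen)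
  have fst_map_γ {t : T} (s : t ⟶ P.x ⊞ Q.x) : (biprod.fst : X ⊞ Y ⟶ X).app _
      ((X ⊞ Y).map s.op γ) = X.map (s ≫ biprod.fst).op P.gen := by
    rw [NatTrans.naturality_apply, hγ₁, op_comp, Functor.map_comp_apply]
  have snd_map_γ {t : T} (s : t ⟶ P.x ⊞ Q.x) : (biprod.snd : X ⊞ Y ⟶ Y).app _
      ((X ⊞ Y).map s.op γ) = Y.map (s ≫ biprod.snd).op Q.gen := by
    rw [NatTrans.naturality_apply, hγ₂, op_comp, Functor.map_comp_apply]
  refine ⟨{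
    x := P.x ⊞ Q.x
    y := P.y ⊞ Q.y
    rel := biprod.map P.rel Q.rel
    gen := γ
    map_add_gen := fun s s' => biprod_app_ext ?_ ?_
    exists_map_gen_eq := fun {t} a => ?_
    map_gen_eq_zero_iff := fun {t} s => ?_ }⟩
  · simp only [map_add, fst_map_γ, Preadditive.add_comp, map_op_add_apply]
  · simp only [map_add, snd_map_γ, Preadditive.add_comp, map_op_add_apply]
  · obtain ⟨s, hs⟩ := P.exists_map_gen_eq ((biprod.fst : X ⊞ Y ⟶ X).app _ a)
    obtain ⟨s', hs'⟩ := Q.exists_map_gen_eq ((biprod.snd : X ⊞ Y ⟶ Y).app _ a)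
    refine ⟨biprod.lift s s', biprod_app_ext ?_ ?_⟩
    · rw [fst_map_γ, biprod.lift_fst, hs]
    · rw [snd_map_γ, biprod.lift_snd, hs']
  · have : (X ⊞ Y).map s.op γ = 0 ↔ X.map (s ≫ biprod.fst).op P.gen = 0 ∧
        Y.map (s ≫ biprod.snd).op Q.gen = 0 := by
      rw [← fst_map_γ, ← snd_map_γ]
      exact ⟨fun h => by simp only [h, map_zero, and_self], fun h => biprod_app_ext
        (h.1.trans (map_zero _).symm) (h.2.trans (map_zero _).symm)⟩
    rw [this, P.map_gen_eq_zero_iff, Q.map_gen_eq_zero_iff]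
    constructor
    · rintro ⟨⟨k, hk⟩, ⟨l, hl⟩⟩
      exact ⟨biprod.lift k l, by ext <;> simp [hk, hl]⟩
    · rintro ⟨k, rfl⟩
      exact ⟨⟨k ≫ biprod.fst, by simp⟩, ⟨k ≫ biprod.snd, by simp⟩⟩

end Biproducts

end Presentation

lemma finitelyPresentable_iff {X : Tᵒᵖ ⥤ AddCommGrpCat.{v}} :
    finitelyPresentable T X ↔ Nonempty (Presentation X) := by
  constructor
  · rintro ⟨x, y, f, p, hfp, hex, hp⟩
    obtain ⟨g, rfl⟩ := preadditiveYoneda.map_surjective f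
    exact ⟨.ofExact hex hp⟩
  · rintro ⟨P⟩
    obtain ⟨p, hp⟩ := P.exists_cover
    refine ⟨P.x, P.y, preadditiveYoneda.map P.rel, p, ?_, ?_, ?_⟩
    · ext ⟨t⟩ k
      exact (hp _).trans ((P.map_gen_eq_zero_iff _).2 ⟨k, rfl⟩)
    · exact exact_iff_app.2 fun t s hs => (P.map_gen_eq_zero_iff s).1 ((hp s).symm.trans hs)
    · refine epi_iff_surjective_app.2 fun t a => ?_
      obtain ⟨s, rfl⟩ := P.exists_map_gen_eq a
      exact ⟨s, hp s⟩

/-- A chosen presentation of an object of `A(T)`. -/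
noncomputable def presentation (X : Abelianization T) : Presentation X.obj :=
  (finitelyPresentable_iff.1 X.property).some

instance additive_obj (X : Abelianization T) : X.obj.Additive := (presentation X).additive

instance : (finitelyPresentable T).IsClosedUnderIsomorphisms where
  of_iso e h := by
    rw [finitelyPresentable_iff] at h ⊢
    exact ⟨h.some.ofIso e⟩

open ZeroObject in
instance [HasZeroObject T] : (finitelyPresentable T).ContainsZero where
  exists_zero := by
    refine ⟨preadditiveYoneda.obj 0, ?_, finitelyPresentable_iff.2 ⟨.yoneda 0⟩⟩
    rw [IsZero.iff_id_eq_zero, ← preadditiveYoneda.map_id, id_zero, Functor.map_zero]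

section Biproducts

variable [HasBinaryBiproducts T]

instance : (finitelyPresentable T).IsClosedUnderCokernels where
  cokernels_le := by
    rintro _ ⟨f, k, hk, hX, hY⟩
    rw [finitelyPresentable_iff] at hX hY
    exact (finitelyPresentable T).prop_of_iso
      (IsColimit.coconePointUniqueUpToIso (cokernelIsCokernel f) hk)
      (finitelyPresentable_iff.2 (hX.some.nonempty_cokernel hY.some f))

instance : (finitelyPresentable T).IsClosedUnderBinaryProducts where
  limitsOfShape_le := by
    rintro X ⟨h⟩
    have presented (j : WalkingPair) : Nonempty (Presentation (h.diag.obj ⟨j⟩)) :=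
      finitelyPresentable_iff.1 (h.prop_diag_obj ⟨j⟩)
    exact (finitelyPresentable T).prop_of_iso
      (IsLimit.conePointsIsoOfNatIso (BinaryBiproduct.isLimit _ _) h.isLimit
        (diagramIsoPair h.diag).symm)
      (finitelyPresentable_iff.2 ((presented .left).some.nonempty_biprod (presented .right).some))

instance [HasZeroObject T] : (finitelyPresentable T).IsClosedUnderFiniteProducts := .mk'

end Biproducts

lemma Presentation.small_hom {X : Tᵒᵖ ⥤ AddCommGrpCat.{v}} (P : Presentation X)
    (G : Tᵒᵖ ⥤ AddCommGrpCat.{v}) : Small.{v} (X ⟶ G) :=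
  small_of_injective (β := G.obj (op P.x)) (f := fun a => a.app (op P.x) P.gen)
    fun _ _ h => P.hom_ext h

instance locallySmall_abelianization : LocallySmall.{v} (Abelianization T) where
  hom_small X Y := by
    have := (presentation X).small_hom Y.obj
    exact small_of_injective (β := X.obj ⟶ Y.obj) (f := fun f => f.hom)
      fun _ _ h => ObjectProperty.hom_ext _ h

instance (F : Tᵒᵖ ⥤ AddCommGrpCat.{v}) : (homInto F).Additive where
  map_add {_ _ f g} := by
    ext φ
    exact Preadditive.add_comp (C := Tᵒᵖ ⥤ AddCommGrpCat.{v}) _ _ _ f.unop.hom g.unop.hom φ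

end Presentations

/-! ### Homotopy cartesian squares -/

section Triangulated

variable {T : Type w} [Category.{v} T] [Preadditive T] [HasZeroObject T] [HasShift T ℤ]
  [∀ n : ℤ, (shiftFunctor T n).Additive] [Pretriangulated T]

open Pretriangulated ZeroObject

/-- The square `i ≫ v = j ≫ g` is homotopy cartesian: `(i, j)` and `(v, -g)` are consecutive
morphisms of a distinguished triangle. Such squares are the weak pullbacks of `T`. -/
def IsHomotopyCartesian {e a d c : T} (i : e ⟶ a) (j : e ⟶ d) (v : a ⟶ c) (g : d ⟶ c) : Prop :=
  ∃ h : c ⟶ e⟦(1 : ℤ)⟧, Triangle.mk (biprod.lift i j) (biprod.desc v (-g)) h ∈ distTriang T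

lemma exists_isHomotopyCartesian {a d c : T} (v : a ⟶ c) (g : d ⟶ c) :
    ∃ (e : T) (i : e ⟶ a) (j : e ⟶ d), IsHomotopyCartesian i j v g := by
  obtain ⟨e, f, h, mem⟩ := distinguished_cocone_triangle₁ (biprod.desc v (-g))
  refine ⟨e, f ≫ biprod.fst, f ≫ biprod.snd, h, ?_⟩
  rwa [show biprod.lift (f ≫ biprod.fst) (f ≫ biprod.snd) = f by ext <;> simp]

namespace IsHomotopyCartesian

variable {e a d c : T} {i : e ⟶ a} {j : e ⟶ d} {v : a ⟶ c} {g : d ⟶ c}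
  (sq : IsHomotopyCartesian i j v g)

include sq

lemma w : i ≫ v = j ≫ g := by
  obtain ⟨h, mem⟩ := sq
  have : biprod.lift i j ≫ biprod.desc v (-g) = 0 := comp_distTriang_mor_zero₁₂ _ mem
  rwa [biprod.lift_desc, Preadditive.comp_neg, add_neg_eq_zero] at this

lemma exists_lift {t : T} (s : t ⟶ a) (l : t ⟶ d) (hsl : s ≫ v = l ≫ g) :
    ∃ k : t ⟶ e, k ≫ i = s ∧ k ≫ j = l := by
  obtain ⟨h, mem⟩ := sq
  have zero : biprod.lift s l ≫ biprod.desc v (-g) = 0 := by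
    rw [biprod.lift_desc, Preadditive.comp_neg, hsl, add_neg_cancel]
  obtain ⟨k, hk⟩ : ∃ k : t ⟶ e, biprod.lift s l = k ≫ biprod.lift i j :=
    Triangle.coyoneda_exact₂ _ mem (biprod.lift s l) zero
  refine ⟨k, ?_, ?_⟩
  · simpa using congrArg (· ≫ biprod.fst) hk.symm
  · simpa using congrArg (· ≫ biprod.snd) hk.symm

lemma exists_of_map_eq_map (F : Tᵒᵖ ⥤ AddCommGrpCat.{u}) [F.IsHomological]
    (φ : F.obj (op a)) (χ : F.obj (op d)) (h : F.map i.op φ = F.map j.op χ) :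
    ∃ ψ : F.obj (op c), F.map v.op ψ = φ ∧ F.map g.op ψ = χ := by
  obtain ⟨_, mem⟩ := sq
  let ξ : F.obj (op (a ⊞ d)) := F.map biprod.fst.op φ - F.map biprod.snd.op χ
  have map_ξ : ∀ {r : T} (k : r ⟶ a ⊞ d), F.map k.op ξ =
      F.map (k ≫ biprod.fst).op φ - F.map (k ≫ biprod.snd).op χ := fun k => by
    simp only [ξ, map_sub, op_comp, Functor.map_comp_apply]
  obtain ⟨ψ, hψ⟩ : ∃ ψ : F.obj (op c), F.map (biprod.desc v (-g)).op ψ = ξ :=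
    (ShortComplex.ab_exact_iff _).1 (F.map_distinguished_op_exact _ mem) ξ <|
      (map_ξ (biprod.lift i j)).trans <| by
        rw [biprod.lift_fst, biprod.lift_snd, h]
        exact sub_self _
  have map_ψ : ∀ {r : T} (k : r ⟶ a ⊞ d), F.map (k ≫ biprod.desc v (-g)).op ψ =
      F.map (k ≫ biprod.fst).op φ - F.map (k ≫ biprod.snd).op χ := fun k => by
    rw [op_comp, Functor.map_comp_apply, hψ, map_ξ]
  refine ⟨ψ, ?_, ?_⟩
  · simpa [map_op_zero_apply] using map_ψ biprod.inl
  · simpa [map_op_zero_apply] using map_ψ biprod.inr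

end IsHomotopyCartesian

/-! ### The abelianization of a triangulated category is abelian -/

namespace Presentation

variable {X Y : Tᵒᵖ ⥤ AddCommGrpCat.{v}}

lemma exists_map_eq_zero_iff (Q : Presentation Y) {a : T} (η : Y.obj (op a)) :
    ∃ (e : T) (i : e ⟶ a), ∀ {t : T} (s : t ⟶ a), Y.map s.op η = 0 ↔ ∃ k : t ⟶ e, k ≫ i = s := by
  obtain ⟨v, rfl⟩ := Q.exists_map_gen_eq η
  obtain ⟨e, i, j, sq⟩ := exists_isHomotopyCartesian v Q.rel
  refine ⟨e, i, fun s => ?_⟩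
  rw [← Functor.map_comp_apply, ← op_comp, Q.map_gen_eq_zero_iff]
  constructor
  · rintro ⟨l, hl⟩
    obtain ⟨k, hk, -⟩ := sq.exists_lift s l hl.symm
    exact ⟨k, hk⟩
  · rintro ⟨k, rfl⟩
    exact ⟨k ≫ j, by rw [Category.assoc, Category.assoc, sq.w]⟩

lemma nonempty_of_mono (P : Presentation X) (m : Y ⟶ X) [Mono m] {e : T} (η : Y.obj (op e))
    (hη : ∀ {t : T} (a : Y.obj (op t)), ∃ s : t ⟶ e, Y.map s.op η = a) :
    Nonempty (Presentation Y) := by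
  have := P.additive
  have injective_app {t : T} := mono_iff_injective_app.1 (inferInstance : Mono m) t
  obtain ⟨e', i, hi⟩ := P.exists_map_eq_zero_iff (m.app _ η)
  exact ⟨{
    x := e
    y := e'
    rel := i
    gen := η
    map_add_gen := fun s s' => injective_app <| by
      simp only [map_add, NatTrans.naturality_apply, map_op_add_apply]
    exists_map_gen_eq := hη
    map_gen_eq_zero_iff := fun {t} s => by
      rw [← hi, ← NatTrans.naturality_apply]
      exact (map_eq_zero_iff (m.app (op t)).hom injective_app).symm }⟩

lemma nonempty_kernel (P : Presentation X) (Q : Presentation Y) (f : X ⟶ Y) :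
    Nonempty (Presentation (kernel f)) := by
  have apply_eq_zero {t : T} (a : (kernel f).obj (op t)) :
      f.app (op t) ((kernel.ι f).app (op t) a) = 0 :=
    ConcreteCategory.congr_hom (NatTrans.congr_app (kernel.condition f) (op t)) a
  obtain ⟨e, i, hi⟩ := Q.exists_map_eq_zero_iff (f.app _ P.gen)
  obtain ⟨η, hη⟩ := exact_iff_app.1 (ShortComplex.exact_kernel f) e (X.map i.op P.gen) <|
    (NatTrans.naturality_apply f i.op P.gen).trans ((hi i).2 ⟨𝟙 e, Category.id_comp i⟩)
  refine P.nonempty_of_mono (kernel.ι f) η fun {t} a => ?_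
  obtain ⟨s, hs⟩ := P.exists_map_gen_eq ((kernel.ι f).app (op t) a)
  obtain ⟨k, rfl⟩ := (hi s).1 <| by rw [← NatTrans.naturality_apply, hs, apply_eq_zero]
  refine ⟨k, mono_iff_injective_app.1 (inferInstance : Mono (kernel.ι f)) t ?_⟩
  rw [NatTrans.naturality_apply, ← hs, op_comp, Functor.map_comp_apply]
  exact congrArg _ hη

end Presentation

instance : (finitelyPresentable T).IsClosedUnderKernels where
  kernels_le := by
    rintro _ ⟨f, k, hk, hX, hY⟩
    rw [finitelyPresentable_iff] at hX hY
    exact (finitelyPresentable T).prop_of_iso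
      (IsLimit.conePointUniqueUpToIso (kernelIsKernel f) hk)
      (finitelyPresentable_iff.2 (hX.some.nonempty_kernel hY.some f))

instance : (finitelyPresentable T).ι.PreservesHomology where
  preservesKernels _ _ f := (finitelyPresentable T).preservesKernels_ι f
  preservesCokernels _ _ f := (finitelyPresentable T).preservesCokernels_ι f

/-! ### Homological functors are injective relative to finitely presentable modules -/

variable (F : Tᵒᵖ ⥤ AddCommGrpCat.{v}) [F.IsHomological]

lemma Presentation.exists_extension {X Y : Tᵒᵖ ⥤ AddCommGrpCat.{v}} (P : Presentation X)
    (Q : Presentation Y) (m : X ⟶ Y) [Mono m] (φ : X ⟶ F) : ∃ ψ : Y ⟶ F, m ≫ ψ = φ := by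
  obtain ⟨v, hv⟩ := Q.exists_map_gen_eq (m.app _ P.gen)
  obtain ⟨e, i, j, sq⟩ := exists_isHomotopyCartesian v Q.rel
  have map_i_gen : X.map i.op P.gen = 0 := by
    refine mono_iff_injective_app.1 (inferInstance : Mono m) e ?_
    rw [map_zero, NatTrans.naturality_apply, ← hv, ← Functor.map_comp_apply, ← op_comp,
      Q.map_gen_eq_zero_iff]
    exact ⟨j, sq.w.symm⟩
  obtain ⟨ψ₀, hψv, hψg⟩ := sq.exists_of_map_eq_map F (φ.app _ P.gen) 0 <| by
    rw [← NatTrans.naturality_apply, map_i_gen, map_zero, map_zero]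
  obtain ⟨ψ, hψ⟩ := Q.exists_desc ψ₀ hψg
  refine ⟨ψ, P.hom_ext ?_⟩
  change ψ.app _ (m.app _ P.gen) = _
  rw [← hv, NatTrans.naturality_apply, hψ, hψv]

lemma shortExact_map_homInto {S : ShortComplex (Abelianization T)ᵒᵖ} (hS : S.ShortExact) :
    (S.map (homInto F)).ShortExact := by
  have := (finitelyPresentable T).preservesMonomorphisms_ι_of_isNormalEpiCategory
  have := (finitelyPresentable T).preservesEpimorphisms_ι_of_isNormalMonoCategory
  have hS' := hS.unop
  have : Mono S.unop.f := hS'.mono_f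
  have : Epi S.unop.g := hS'.epi_g
  have exact_modules : (S.unop.map (finitelyPresentable T).ι).ShortExact :=
    hS'.map (finitelyPresentable T).ι
  have : Mono S.unop.f.hom := exact_modules.mono_f
  have : Epi S.unop.g.hom := exact_modules.epi_g
  have : Epi (S.unop.map (finitelyPresentable T).ι).g := exact_modules.epi_g
  exact
    { exact := (ShortComplex.ab_exact_iff _).2 fun φ hφ =>
        ⟨exact_modules.exact.desc φ hφ, exact_modules.exact.g_desc φ hφ⟩
      mono_f := (AddCommGrpCat.mono_iff_injective _).2 fun _ _ h => (cancel_epi S.unop.g.hom).1 h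
      epi_g := (AddCommGrpCat.epi_iff_surjective _).2
        ((presentation _).exists_extension F (presentation _) S.unop.f.hom) }

lemma exact_homInto : PreservesFiniteLimits (homInto F) ∧ PreservesFiniteColimits (homInto F) :=
  ((homInto F).exact_tfae.out 0 3).1 fun _ hS => shortExact_map_homInto F hS

end Triangulated

/-! ### Coproducts in the abelianization -/

section MapsToProduct

variable {C : Type*} [Category* C] {J : Type*} {X : J → C}

/-- The contravariant functor `F` sends the cofan `c` to a product. In contrast to
`SendsCoproductsToProducts`, the universes of `J` and of the values of `F` are unrelated. -/
def MapsToProduct (F : Cᵒᵖ ⥤ AddCommGrpCat.{u}) (c : Cofan X) : Prop :=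
  Function.Bijective fun (x : F.obj (op c.pt)) (j : J) => F.map (c.inj j).op x

namespace MapsToProduct

variable {F : Cᵒᵖ ⥤ AddCommGrpCat.{u}} {c : Cofan X}

lemma ext (h : MapsToProduct F c) {a b : F.obj (op c.pt)}
    (hab : ∀ j, F.map (c.inj j).op a = F.map (c.inj j).op b) : a = b :=
  h.injective (funext hab)

lemma exists_map_eq (h : MapsToProduct F c) (a : ∀ j, F.obj (op (X j))) :
    ∃ x : F.obj (op c.pt), ∀ j, F.map (c.inj j).op x = a j :=
  (h.surjective a).imp fun _ => congrFun

lemma of_isColimit (h : MapsToProduct F c) (hc : IsColimit c) {c' : Cofan X} (hc' : IsColimit c') :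
    MapsToProduct F c' := by
  let e : c.pt ≅ c'.pt := hc.coconePointUniqueUpToIso hc'
  have inj_comp (j : J) : c.inj j ≫ e.hom = c'.inj j :=
    hc.comp_coconePointUniqueUpToIso_hom hc' ⟨j⟩
  have factor : (fun (x : F.obj (op c'.pt)) (j : J) => F.map (c'.inj j).op x) =
      (fun (x : F.obj (op c.pt)) (j : J) => F.map (c.inj j).op x) ∘ F.map e.hom.op := by
    funext x j
    rw [← inj_comp, op_comp, Functor.map_comp_apply]
    rfl
  rw [MapsToProduct, factor]
  exact Function.Bijective.comp h (ConcreteCategory.bijective_of_isIso (F.map e.hom.op))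

end MapsToProduct

end MapsToProduct

section Coproducts

variable {T : Type w} [Category.{v} T] [Preadditive T] {J : Type u}

namespace Presentation

lemma mapsToProduct {X : Tᵒᵖ ⥤ AddCommGrpCat.{v}} (P : Presentation X) {t : J → T} {c : Cofan t}
    (hc : IsColimit c) : MapsToProduct X c := by
  constructor
  · intro a b hab
    obtain ⟨s, rfl⟩ := P.exists_map_gen_eq a
    obtain ⟨s', rfl⟩ := P.exists_map_gen_eq b
    have relation (j : J) : ∃ k : t j ⟶ P.y, k ≫ P.rel = c.inj j ≫ (s - s') := by
      rw [Preadditive.comp_sub, ← P.map_gen_eq_iff]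
      simpa only [op_comp, Functor.map_comp_apply] using congrFun hab j
    choose k hk using relation
    refine P.map_gen_eq_iff.2 ⟨Cofan.IsColimit.desc hc k,
      Cofan.IsColimit.hom_ext hc _ _ fun j => ?_⟩
    rw [← hk, Cofan.IsColimit.fac_assoc]
  · intro a
    choose s hs using fun j => P.exists_map_gen_eq (a j)
    refine ⟨X.map (Cofan.IsColimit.desc hc s).op P.gen, funext fun j => ?_⟩
    beta_reduce
    rw [← Functor.map_comp_apply, ← op_comp, Cofan.IsColimit.fac, hs]

variable {X : J → Tᵒᵖ ⥤ AddCommGrpCat.{v}} (P : ∀ j, Presentation (X j))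
  [HasCoproductsOfShape J T]

/-- The coproduct of the presented modules `X j`, as the cokernel of the coproduct of the
relations. -/
noncomputable def sigmaObj : Tᵒᵖ ⥤ AddCommGrpCat.{v} :=
  cokernel (preadditiveYoneda.map (Limits.Sigma.map fun j => (P j).rel))

/-- The presentation of `sigmaObj P` by coproducts of the generators and of the relations. -/
noncomputable def sigma : Presentation (sigmaObj P) :=
  ofHom (Limits.Sigma.map fun j => (P j).rel)

/-- The coproduct of the objects representing the generators. -/
noncomputable abbrev generatorsCofan : Cofan fun j => (P j).x :=
  Cofan.mk (sigma P).x (Sigma.ι fun j => (P j).x)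

/-- The coproduct of the objects representing the relations. -/
noncomputable abbrev relationsCofan : Cofan fun j => (P j).y :=
  Cofan.mk (sigma P).y (Sigma.ι fun j => (P j).y)

lemma relationsCofan_inj_comp_rel (j : J) :
    (relationsCofan P).inj j ≫ (sigma P).rel = (P j).rel ≫ (generatorsCofan P).inj j :=
  Limits.Sigma.ι_map (fun j => (P j).rel) j

lemma exists_sigmaι (j : J) : ∃ i : X j ⟶ sigmaObj P, i.app (op (P j).x) (P j).gen =
    (sigmaObj P).map ((generatorsCofan P).inj j).op (sigma P).gen := by
  have := (sigma P).additive
  refine (P j).exists_desc _ ?_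
  rw [← Functor.map_comp_apply, ← op_comp, (sigma P).map_gen_eq_zero_iff]
  exact ⟨_, relationsCofan_inj_comp_rel P j⟩

/-- The inclusions into the coproduct of presented modules. -/
noncomputable def sigmaι (j : J) : X j ⟶ sigmaObj P := (exists_sigmaι P j).choose

lemma sigmaι_comp_app_gen {Z : Tᵒᵖ ⥤ AddCommGrpCat.{v}} (φ : sigmaObj P ⟶ Z) (j : J) :
    (sigmaι P j ≫ φ).app (op (P j).x) (P j).gen =
      Z.map ((generatorsCofan P).inj j).op (φ.app _ (sigma P).gen) := by
  rw [← NatTrans.naturality_apply, ← (exists_sigmaι P j).choose_spec]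
  rfl

lemma mapsToProduct_sigma {Z : Tᵒᵖ ⥤ AddCommGrpCat.{v}} [Z.Additive]
    (hZ : ∀ {t : J → T} {c : Cofan t}, IsColimit c → MapsToProduct Z c) :
    MapsToProduct (preadditiveYoneda.obj Z) (Cofan.mk (sigmaObj P) (sigmaι P)) := by
  have on_generators : MapsToProduct Z (generatorsCofan P) := hZ (coproductIsCoproduct _)
  have on_relations : MapsToProduct Z (relationsCofan P) := hZ (coproductIsCoproduct _)
  constructor
  · intro (φ : sigmaObj P ⟶ Z) (φ' : sigmaObj P ⟶ Z) h
    have comp_eq (j : J) : sigmaι P j ≫ φ = sigmaι P j ≫ φ' := congrFun h j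
    exact (sigma P).hom_ext <| on_generators.ext fun j => (sigmaι_comp_app_gen P φ j).symm.trans <|
      (comp_eq j ▸ rfl : _ = _).trans (sigmaι_comp_app_gen P φ' j)
  · intro (ψ : ∀ j, X j ⟶ Z)
    obtain ⟨γ, hγ⟩ := on_generators.exists_map_eq fun j => (ψ j).app _ (P j).gen
    obtain ⟨φ, hφ⟩ := (sigma P).exists_desc γ <| on_relations.ext fun j => by
      rw [← Functor.map_comp_apply, ← op_comp, relationsCofan_inj_comp_rel, op_comp,
        Functor.map_comp_apply, hγ, ← NatTrans.naturality_apply, map_rel_gen, map_zero, map_zero]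
    refine ⟨φ, funext fun j => (P j).hom_ext ?_⟩
    rw [← hγ, ← hφ]
    exact sigmaι_comp_app_gen P φ j

end Presentation

/-- The coproduct of the objects `X j` of `A(T)`. -/
noncomputable def sigmaCofan [HasCoproductsOfShape J T] (X : J → Abelianization T) : Cofan X :=
  Cofan.mk ⟨Presentation.sigmaObj fun j => presentation (X j),
    finitelyPresentable_iff.2 ⟨Presentation.sigma _⟩⟩
    fun j => ObjectProperty.homMk (Presentation.sigmaι (fun j => presentation (X j)) j)

lemma nonempty_isColimit_of_mapsToProduct_homInto {X : J → Abelianization T} {c : Cofan X}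
    (hc : ∀ Y : Abelianization T, MapsToProduct (homInto Y.obj) c) : Nonempty (IsColimit c) := by
  choose φ hφ using fun s : Cofan X => (hc s.pt).exists_map_eq fun j => (s.inj j).hom
  exact ⟨Cofan.IsColimit.mk c (fun s => ObjectProperty.homMk (φ s))
    (fun s j => ObjectProperty.hom_ext _ (hφ s j)) fun s m hm => ObjectProperty.hom_ext _ <|
      (hc s.pt).ext fun j => (congrArg (·.hom) (hm j)).trans (hφ s j).symm⟩

lemma nonempty_isColimit_sigmaCofan [HasCoproductsOfShape J T] (X : J → Abelianization T) :
    Nonempty (IsColimit (sigmaCofan X)) :=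
  nonempty_isColimit_of_mapsToProduct_homInto fun Y =>
    Presentation.mapsToProduct_sigma (fun j => presentation (X j))
      (presentation Y).mapsToProduct

instance hasCoproducts_abelianization [HasCoproducts.{u} T] :
    HasCoproducts.{u} (Abelianization T) :=
  hasCoproducts_of_colimit_cofans sigmaCofan fun X => (nonempty_isColimit_sigmaCofan X).some

lemma mapsToProduct_homInto [HasCoproductsOfShape J T] {F : Tᵒᵖ ⥤ AddCommGrpCat.{v}} [F.Additive]
    (hF : ∀ {t : J → T} {c : Cofan t}, IsColimit c → MapsToProduct F c)
    {X : J → Abelianization T} {c : Cofan X} (hc : IsColimit c) : MapsToProduct (homInto F) c :=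
  MapsToProduct.of_isColimit (c := sigmaCofan X)
    (Presentation.mapsToProduct_sigma (fun j => presentation (X j)) hF)
    (nonempty_isColimit_sigmaCofan X).some hc

end Coproducts

/-! ### Functors with small values -/

section SmallValues

lemma exists_comp_uliftFunctor_iso {C : Type*} [Category* C] (G : C ⥤ AddCommGrpCat.{max u w})
    [∀ X, Small.{u} (G.obj X)] :
    ∃ F : C ⥤ AddCommGrpCat.{u}, Nonempty (F ⋙ AddCommGrpCat.uliftFunctor.{w, u} ≅ G) := by
  have mem_essImage (X : C) : AddCommGrpCat.uliftFunctor.{w, u}.essImage (G.obj X) :=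
    ⟨AddCommGrpCat.of (Shrink.{u} (G.obj X)),
      ⟨(AddEquiv.ulift.trans Shrink.addEquiv).toAddCommGrpIso⟩⟩
  exact ⟨_, ⟨Functor.essImage.liftFunctorCompIso G _ mem_essImage⟩⟩

variable {C : Type*} [Category* C] {F : C ⥤ AddCommGrpCat.{u}} {G : C ⥤ AddCommGrpCat.{max u w}}
  (e : F ⋙ AddCommGrpCat.uliftFunctor.{w, u} ≅ G)

/-- The identification of the values of `F` with those of its universe lift `G`. -/
noncomputable def uliftIsoEquiv (X : C) : F.obj X ≃+ G.obj X :=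
  AddEquiv.ulift.symm.trans (e.app X).addCommGroupIsoToAddEquiv

lemma uliftIsoEquiv_map {X Y : C} (f : X ⟶ Y) (a : F.obj X) :
    uliftIsoEquiv e Y (F.map f a) = G.map f (uliftIsoEquiv e X a) :=
  ConcreteCategory.congr_hom (e.hom.naturality f) (ULift.up a)

lemma uliftIsoEquiv_symm_map {X Y : C} (f : X ⟶ Y) (a : G.obj X) :
    (uliftIsoEquiv e Y).symm (G.map f a) = F.map f ((uliftIsoEquiv e X).symm a) := by
  rw [AddEquiv.symm_apply_eq, uliftIsoEquiv_map, AddEquiv.apply_symm_apply]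

lemma MapsToProduct.of_uliftIso {F : Cᵒᵖ ⥤ AddCommGrpCat.{u}} {G : Cᵒᵖ ⥤ AddCommGrpCat.{max u w}}
    (e : F ⋙ AddCommGrpCat.uliftFunctor.{w, u} ≅ G) {J : Type*} {X : J → C} {c : Cofan X}
    (h : MapsToProduct G c) : MapsToProduct F c := by
  constructor
  · exact fun a b hab => (uliftIsoEquiv e _).injective <| h.ext fun j => by
      rw [← uliftIsoEquiv_map, ← uliftIsoEquiv_map]
      exact congrArg _ (congrFun hab j)
  · intro a
    obtain ⟨b, hb⟩ := h.exists_map_eq fun j => uliftIsoEquiv e _ (a j)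
    exact ⟨(uliftIsoEquiv e _).symm b, funext fun j => by
      beta_reduce
      rw [← uliftIsoEquiv_symm_map, hb, AddEquiv.symm_apply_apply]⟩

include e

lemma additive_of_uliftIso [Preadditive C] [G.Additive] : F.Additive :=
  have := Functor.additive_of_iso e.symm
  Functor.additive_of_comp_faithful F AddCommGrpCat.uliftFunctor.{w, u}

lemma preservesFiniteLimits_of_uliftIso [PreservesFiniteLimits G] : PreservesFiniteLimits F :=
  have := preservesFiniteLimits_of_natIso e.symm
  preservesFiniteLimits_of_reflects_of_preserves F AddCommGrpCat.uliftFunctor.{w, u}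

lemma preservesFiniteColimits_of_uliftIso [PreservesFiniteColimits G] :
    PreservesFiniteColimits F :=
  have := preservesFiniteColimits_of_natIso e.symm
  preservesFiniteColimits_of_reflects_of_preserves F AddCommGrpCat.uliftFunctor.{w, u}

lemma isHomological_of_uliftIso [Preadditive C] [HasZeroObject C] [HasShift C ℤ]
    [∀ n : ℤ, (shiftFunctor C n).Additive] [Pretriangulated C] [G.IsHomological] :
    F.IsHomological :=
  have := Functor.IsHomological.of_iso e.symm
  have := additive_of_uliftIso e
  { exact := fun D hD => (ShortComplex.exact_map_iff_of_faithful _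
      AddCommGrpCat.uliftFunctor.{w, u}).1
        ((F ⋙ AddCommGrpCat.uliftFunctor.{w, u}).map_distinguished_exact D hD) }

end SmallValues

/-! ### Quotients of representable functors -/

section IsQuotientOfRepresentable

variable {C : Type*} [Category* C]

/-- The contravariant functor `F` is a quotient of a representable functor, that is, some
universal element `ξ : F(z)` generates `F`. This necessary condition for representability does
not involve the universe of the morphisms of `C`. -/
def IsQuotientOfRepresentable (F : Cᵒᵖ ⥤ AddCommGrpCat.{u}) : Prop :=
  ∃ (z : C) (ξ : F.obj (op z)), ∀ (t : C) (a : F.obj (op t)), ∃ s : t ⟶ z, F.map s.op ξ = a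

lemma isQuotientOfRepresentable_iff_of_uliftIso {F : Cᵒᵖ ⥤ AddCommGrpCat.{u}}
    {G : Cᵒᵖ ⥤ AddCommGrpCat.{max u w}} (e : F ⋙ AddCommGrpCat.uliftFunctor.{w, u} ≅ G) :
    IsQuotientOfRepresentable F ↔ IsQuotientOfRepresentable G := by
  constructor
  · rintro ⟨z, ξ, hξ⟩
    refine ⟨z, uliftIsoEquiv e _ ξ, fun t a => ?_⟩
    obtain ⟨s, hs⟩ := hξ t ((uliftIsoEquiv e _).symm a)
    refine ⟨s, ?_⟩
    rw [← uliftIsoEquiv_map, hs, AddEquiv.apply_symm_apply]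
  · rintro ⟨z, ξ, hξ⟩
    refine ⟨z, (uliftIsoEquiv e _).symm ξ, fun t a => ?_⟩
    obtain ⟨s, hs⟩ := hξ t (uliftIsoEquiv e _ a)
    refine ⟨s, ?_⟩
    rw [← uliftIsoEquiv_symm_map, hs, AddEquiv.symm_apply_apply]

lemma IsRepresentableAb.isQuotientOfRepresentable {C : Type w} [Category.{max u v} C]
    [Preadditive C] {F : Cᵒᵖ ⥤ AddCommGrpCat.{u}} (hF : IsRepresentableAb.{u, v} F) :
    IsQuotientOfRepresentable F := by
  obtain ⟨z, ⟨e⟩⟩ := hF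
  exact (isQuotientOfRepresentable_iff_of_uliftIso e).2
    ⟨z, 𝟙 z, fun t a => ⟨a, Category.comp_id a⟩⟩

lemma isQuotientOfRepresentable_of_homInto {T : Type w} [Category.{v} T] [Preadditive T]
    {F : Tᵒᵖ ⥤ AddCommGrpCat.{v}} [F.Additive] (hF : IsQuotientOfRepresentable (homInto F)) :
    IsQuotientOfRepresentable F := by
  obtain ⟨X, (ξ : X.obj ⟶ F), hξ⟩ := hF
  let P := presentation X
  refine ⟨P.x, ξ.app _ P.gen, fun t a => ?_⟩
  let Y : Abelianization T := ⟨preadditiveYoneda.obj t, finitelyPresentable_iff.2 ⟨.yoneda t⟩⟩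
  obtain ⟨φ, hφ⟩ : ∃ φ : Y.obj ⟶ F, φ.app (op t) (𝟙 t) = a :=
    (Presentation.yoneda t).exists_desc a (map_op_zero_apply F a)
  obtain ⟨f, hf : f.hom ≫ ξ = φ⟩ := hξ Y φ
  refine (P.exists_map_gen_eq (f.hom.app (op t) (𝟙 t))).imp fun s hs => ?_
  rw [← NatTrans.naturality_apply, hs, ← hφ, ← hf]
  rfl

end IsQuotientOfRepresentable

/-! ### Products of families of representable functors -/

section FamilyProduct

variable {T : Type*} [Category.{v} T] [Preadditive T] {I : Type w} (Y : I → T)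

/-- The product `∏ i, T(-, Y i)`. The index type `I` may be larger than the morphism types of `T`,
as it is for `classProduct`. -/
def familyProduct : Tᵒᵖ ⥤ AddCommGrpCat.{max w v} where
  obj X := AddCommGrpCat.of (∀ i, X.unop ⟶ Y i)
  map f := AddCommGrpCat.ofHom
    { toFun := fun g i => f.unop ≫ g i
      map_zero' := by funext i; simp
      map_add' := fun g h => by funext i; simp }
  map_id X := by ext g i; simp
  map_comp f g := by ext h i; simp

instance : (familyProduct Y).Additive where
  map_add {X X' f g} := by
    ext a
    funext i
    exact Preadditive.add_comp _ _ _ f.unop g.unop (a i)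

instance [HasZeroObject T] [HasShift T ℤ] [∀ n : ℤ, (shiftFunctor T n).Additive]
    [Pretriangulated T] : (familyProduct Y).IsHomological where
  exact D hD := by
    rw [ShortComplex.ab_exact_iff]
    intro a ha
    choose b hb using fun i => Pretriangulated.Triangle.yoneda_exact₂ _
      (Pretriangulated.unop_distinguished D hD) (a i) (congrFun ha i)
    exact ⟨b, funext fun i => (hb i).symm⟩

lemma mapsToProduct_familyProduct {J : Type*} {X : J → T} {c : Cofan X} (hc : IsColimit c) :
    MapsToProduct (familyProduct Y) c := by
  constructor
  · intro a b hab
    funext i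
    exact Cofan.IsColimit.hom_ext hc _ _ fun j => congrFun (congrFun hab j) i
  · intro a
    exact ⟨fun i => Cofan.IsColimit.desc hc fun j => a j i,
      funext fun j => funext fun i => Cofan.IsColimit.fac hc _ j⟩

lemma small_familyProduct_obj {X : T} {s : Set I} [Small.{v} s]
    (hs : ∀ i ∉ s, Subsingleton (X ⟶ Y i)) : Small.{v} ((familyProduct Y).obj (op X)) := by
  refine small_of_injective (β := ∀ i : s, X ⟶ Y i) (f := fun a i => a i) fun a b hab => ?_
  funext i
  by_cases hi : i ∈ s
  · exact congrFun hab ⟨i, hi⟩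
  · exact (hs i hi).elim _ _

lemma exists_forall_nonempty_retract (h : IsQuotientOfRepresentable (familyProduct Y)) :
    ∃ z, ∀ i, Nonempty (Retract (Y i) z) := by
  classical
  obtain ⟨z, ξ, hξ⟩ := h
  refine ⟨z, fun i => ?_⟩
  obtain ⟨s, hs⟩ := hξ (Y i) (Pi.single i (𝟙 (Y i)) : ∀ j, Y i ⟶ Y j)
  exact ⟨⟨s, ξ i, (congrFun hs i).trans (Pi.single_eq_same i _)⟩⟩

end FamilyProduct

/-! ### The product of the resolutions of the groups `ℤ^κ` -/

section ResolutionProduct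

lemma isEmpty_retract_resolution_intPower {κ : Cardinal.{u}} (hκ : Cardinal.aleph0 ≤ κ)
    (c : ℕ → ∀ B : AddCommGrpCat.{u}, Precover κ B) {Z : KAb.{u}}
    (hZ : ∀ m, AbLT κ (Z.as.X m)) :
    IsEmpty (Retract ((HomotopyCategory.quotient _ _).obj (resolution c (intPower κ))) Z) :=
  ⟨fun r => not_abLT_intPower hκ <| abLT_of_id_resolution_eq_zero c <| by
    rw [← r.retract, hom_resolution_eq_zero c _ hZ r.r, comp_zero]⟩

variable {I : Type w} {κ : I → Cardinal.{u}}
  (c : ∀ i, ℕ → ∀ B : AddCommGrpCat.{u}, Precover (κ i) B)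

/-- The family of the complexes `Y_{ℤ^κ, κ}`, where `κ` runs through a family of cardinals. -/
noncomputable def resolutionFamily (i : I) : KAb.{u} :=
  (HomotopyCategory.quotient AddCommGrpCat.{u} (ComplexShape.up ℤ)).obj
    (resolution (c i) (intPower (κ i)))

lemma small_familyProduct_resolutionFamily (hκ : Function.Injective κ) (X : KAb.{u}ᵒᵖ) :
    Small.{u} ((familyProduct (resolutionFamily c)).obj X) := by
  obtain ⟨μ, hμ⟩ := exists_forall_abLT X.unop
  have : Small.{u} (κ ⁻¹' Set.Iic μ) := small_of_injective (hκ.restrictPreimage (Set.Iic μ))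
  refine small_familyProduct_obj (resolutionFamily c) (s := κ ⁻¹' Set.Iic μ) fun i hi => ?_
  exact subsingleton_of_forall_eq 0 (hom_resolution_eq_zero (c i) _ (hμ _ (not_le.1 hi)))

lemma not_isQuotientOfRepresentable_familyProduct_resolutionFamily
    (hκ : ¬ BddAbove (Set.range κ)) :
    ¬ IsQuotientOfRepresentable (familyProduct (resolutionFamily c)) := by
  intro h
  obtain ⟨Z, hZ⟩ := exists_forall_nonempty_retract _ h
  obtain ⟨μ, hμ⟩ := exists_forall_abLT Z
  obtain ⟨_, ⟨i, rfl⟩, hi⟩ := not_bddAbove_iff.1 hκ (max Cardinal.aleph0 μ)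
  rw [max_lt_iff] at hi
  exact (isEmpty_retract_resolution_intPower hi.1.le (c i) (hμ _ hi.2)).elim (hZ i).some

end ResolutionProduct

lemma not_bddAbove_range_regularCardinal :
    ¬ BddAbove (Set.range (Subtype.val : RegularCardinal.{u} → Cardinal.{u})) :=
  not_bddAbove_iff.2 fun μ => ⟨_,
    ⟨⟨_, Cardinal.isRegular_succ (le_max_left Cardinal.aleph0 μ)⟩, rfl⟩,
    Order.lt_succ_of_le (le_max_right _ _)⟩

end KAbExample

open KAbExample in
theorem mainTheorem8_general {I : Type w} (κ : I → Cardinal.{u})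
    (κ_injective : Function.Injective κ) (κ_unbounded : ¬ BddAbove (Set.range κ)) :
    HasCoproducts.{u} KAb.{u} ∧
    Nonempty (Abelian (Abelianization KAb.{u})) ∧
    LocallySmall.{u} (Abelianization KAb.{u}) ∧
    HasCoproducts.{u} (Abelianization KAb.{u}) ∧
    (∀ (i : I) (A : AddCommGrpCat.{u}), Nonempty (Precover (κ i) A)) ∧
    ∀ c : (∀ i : I, ℕ → ∀ B : AddCommGrpCat.{u}, Precover (κ i) B),
      ∃ F : KAb.{u}ᵒᵖ ⥤ AddCommGrpCat.{u},
        Nonempty (F ⋙ AddCommGrpCat.uliftFunctor.{w, u} ≅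
          familyProduct (resolutionFamily c)) ∧
        F.IsHomological ∧
        SendsCoproductsToProducts F ∧
        ¬ IsRepresentableAb.{u, u} F ∧
        ∃ Fstar : (Abelianization KAb.{u})ᵒᵖ ⥤ AddCommGrpCat.{u},
          Nonempty (Fstar ⋙ AddCommGrpCat.uliftFunctor.{u + 1, u} ≅ homInto F) ∧
          Fstar.Additive ∧
          PreservesFiniteLimits Fstar ∧
          PreservesFiniteColimits Fstar ∧
          SendsCoproductsToProducts Fstar ∧
          ¬ IsRepresentableAb.{u, u + 1} Fstar := by
  refine ⟨inferInstance, ⟨inferInstance⟩, inferInstance, inferInstance,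
    fun i A => nonempty_precover (κ i) A, fun c => ?_⟩
  have small_product := small_familyProduct_resolutionFamily c κ_injective
  obtain ⟨F, ⟨e⟩⟩ := exists_comp_uliftFunctor_iso.{u, w} (familyProduct (resolutionFamily c))
  have F_homological : F.IsHomological := isHomological_of_uliftIso e
  have F_not_quotient : ¬ IsQuotientOfRepresentable F := fun h =>
    not_isQuotientOfRepresentable_familyProduct_resolutionFamily c κ_unbounded
      ((isQuotientOfRepresentable_iff_of_uliftIso e).1 h)
  have F_product {J : Type u} {X : J → KAb.{u}} {t : Cofan X} (ht : IsColimit t) :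
      MapsToProduct F t := .of_uliftIso e (mapsToProduct_familyProduct _ ht)
  have small_hom (X : (Abelianization KAb.{u})ᵒᵖ) : Small.{u} ((homInto F).obj X) :=
    (presentation X.unop).small_hom F
  obtain ⟨Fstar, ⟨e'⟩⟩ := exists_comp_uliftFunctor_iso.{u, u + 1} (homInto F)
  obtain ⟨_, _⟩ := exact_homInto F
  exact ⟨F, ⟨e⟩, F_homological, fun _ _ _ ⟨ht⟩ => F_product ht,
    fun h => F_not_quotient h.isQuotientOfRepresentable, Fstar, ⟨e'⟩, additive_of_uliftIso e',
    preservesFiniteLimits_of_uliftIso e', preservesFiniteColimits_of_uliftIso e',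
    fun _ _ _ ⟨ht⟩ =>
      MapsToProduct.of_uliftIso e' (mapsToProduct_homInto F_product ht),
    fun h => F_not_quotient <| isQuotientOfRepresentable_of_homInto <|
      (isQuotientOfRepresentable_iff_of_uliftIso e').1 h.isQuotientOfRepresentable⟩

open KAbExample in
theorem mainTheorem8 :
    HasCoproducts.{u} KAb.{u} ∧
    Nonempty (Abelian (Abelianization KAb.{u})) ∧
    LocallySmall.{u} (Abelianization KAb.{u}) ∧
    HasCoproducts.{u} (Abelianization KAb.{u}) ∧
    (∀ (κ : RegularCardinal.{u}) (A : AddCommGrpCat.{u}), Nonempty (Precover κ.1 A)) ∧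
    ∀ c : (∀ κ : RegularCardinal.{u}, ℕ → ∀ B : AddCommGrpCat.{u}, Precover κ.1 B),
      ∃ F : KAb.{u}ᵒᵖ ⥤ AddCommGrpCat.{u},
        Nonempty (F ⋙ AddCommGrpCat.uliftFunctor.{u + 1, u} ≅
          classProduct (resolutionIntPower c)) ∧
        F.IsHomological ∧
        SendsCoproductsToProducts F ∧
        ¬ IsRepresentableAb.{u, u} F ∧
        ∃ Fstar : (Abelianization KAb.{u})ᵒᵖ ⥤ AddCommGrpCat.{u},
          Nonempty (Fstar ⋙ AddCommGrpCat.uliftFunctor.{u + 1, u} ≅ homInto F) ∧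
          Fstar.Additive ∧
          PreservesFiniteLimits Fstar ∧
          PreservesFiniteColimits Fstar ∧
          SendsCoproductsToProducts Fstar ∧
          ¬ IsRepresentableAb.{u, u + 1} Fstar :=
  mainTheorem8_general Subtype.val Subtype.val_injective not_bddAbove_range_regularCardinal
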